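/- A (Kripke) frame $(W,R)$ is a nonempty set $W$ with a binary relation $R$. Put $R^0=\mathrm{Id}_W$, $R^{i+1}=R^i\circ R$, $R^*=\bigcup_{i\ge 0}R^i$. The skeleton of $(W,R)$ is the set of classes of the equivalence $x\sim y\iff xR^*y$ and $yR^*x$, partially ordered by $[x]\le[y]\iff xR^*y$; the height of $(W,R)$ is the largest cardinality of a chain in its skeleton (when a finite largest one exists). Let $\mathcal F(m,n,h)$ be the class of frames of height at most $h$ with $R^n\subseteq R^m$, and $\mathcal G(m,h)$ the class of frames of height at most $h$ with $R^*=\bigcup_{i\le m}R^i$. For a class $\mathcal C$ of frames put $\mathcal C^t=\{(W,R,R^{-1})\mid (W,R)\in\mathcal C\}$; $\mathrm{Log}\,\mathcal C$ is the set of unimodal formulas valid in all frames of $\mathcal C$, and the tense logic $\mathrm{Log}\,\mathcal C^t$ is the set of formulas with two diamonds $\Diamond_1,\Diamond_2$ (interpreted by $R$ and $R^{-1}$) valid in all frames of $\mathcal C^t$. A normal logic is a set of formulas that contains all tautologies and the formulas $\neg\Diamond_i\bot$, $\Diamond_i(p_1\vee p_2)\to\Diamond_ip_1\vee\Diamond_ip_2$,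 and is closed under modus ponens, substitution and the rule $\varphi\to\psi\,/\,\Diamond_i\varphi\to\Diamond_i\psi$; $K+\Phi$ is the least normal unimodal logic containing $\Phi$; a consistent normal logic is canonical if it is valid in its canonical frame. Let $\Diamond^{\le m}\varphi=\bigvee_{i\le m}\Diamond^i\varphi$, $\Box^{\le m}\varphi=\bigwedge_{i\le m}\Box^i\varphi$, $B_1(m)=p_1\to\Box^{\le m}\Diamond^{\le m}p_1$ and $B_{h+1}(m)=p_{h+1}\to\Box^{\le m}(\Diamond^{\le m}p_{h+1}\vee B_h(m))$. Let $n>m\ge 1$ and $h\ge 1$, and let $\mathcal C$ be $\mathcal F(m,n,h)$ or $\mathcal G(m,h)$. Then the tense logic $\mathrm{Log}\,\mathcal C^t$ is decidable. Moreover, $\mathrm{Log}\,\mathcal F(m,n,h)=K+\{\Diamond^np\to\Diamond^mp,\ B_h(n-1)\}$ and $\mathrm{Log}\,\mathcal G(m,h)=K+\{\Diamond^{m+1}p\to\Diamond^{\le m}p,\ B_h(m)\}$, these logics are canonical, and $\mathrm{Log}\,\mathcal C^t$ is the least normal logic with the diamonds $\Diamond_1,\Diamond_2$ that contains $\mathrm{Log}\,\mathcal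 C$ (with $\Diamond$ written as $\Diamond_1$) and the two converse axioms $p\to\neg\Diamond_1\neg\Diamond_2p$ and $p\to\neg\Diamond_2\neg\Diamond_1p$. -/

import Mathlib

universe u

namespace Modal

/-! ### Formulas and their coding by natural numbers -/

/-- Modal formulas with `k` diamonds over the countable set of variables `var 0, var 1, …`.
Falsity and implication are taken as the primitive Boolean connectives; the other ones are the
usual abbreviations below. -/
inductive Formula (k : ℕ) : Type
  | var : ℕ → Formula k
  | bot : Formula k
  | imp : Formula k → Formula k → Formula k
  | dia : Fin k → Formula k → Formula k

namespace Formula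

variable {k : ℕ}

/-- Negation. -/
def neg (φ : Formula k) : Formula k := imp φ bot

/-- Truth. -/
def top : Formula k := neg bot

/-- Disjunction. -/
def or (φ ψ : Formula k) : Formula k := imp (neg φ) ψ

/-- Conjunction. -/
def and (φ ψ : Formula k) : Formula k := neg (imp φ (neg ψ))

/-- The dual of the `i`-th diamond. -/
def box (i : Fin k) (φ : Formula k) : Formula k := neg (dia i (neg φ))

/-- `j` successive applications of the `i`-th diamond. -/
def diaPow (i : Fin k) : ℕ → Formula k → Formula k
  | 0, φ => φ
  | j + 1, φ => dia i (diaPow i j φ)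

/-- `j` successive applications of the `i`-th box. -/
def boxPow (i : Fin k) : ℕ → Formula k → Formula k
  | 0, φ => φ
  | j + 1, φ => box i (boxPow i j φ)

/-- The disjunction of `diaPow i j φ` over `j = 0, …, m`. -/
def diaLe (i : Fin k) : ℕ → Formula k → Formula k
  | 0, φ => φ
  | m + 1, φ => or (diaLe i m φ) (diaPow i (m + 1) φ)

/-- The conjunction of `boxPow i j φ` over `j = 0, …, m`. -/
def boxLe (i : Fin k) : ℕ → Formula k → Formula k
  | 0, φ => φ
  | m + 1, φ => and (boxLe i m φ) (boxPow i (m + 1) φ)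

/-- The conjunction of a finite list of formulas. -/
def conj : List (Formula k) → Formula k
  | [] => top
  | φ :: l => and φ (conj l)

/-- Uniform substitution of formulas for variables. -/
def subst (σ : ℕ → Formula k) : Formula k → Formula k
  | var n => σ n
  | bot => bot
  | imp φ ψ => imp (subst σ φ) (subst σ ψ)
  | dia i φ => dia i (subst σ φ)

/-- The Boolean value of a formula when variables and formulas that begin with a diamond are
treated as propositional atoms. -/
def boolVal (v : Formula k → Prop) : Formula k → Prop
  | var n => v (var n)
  | bot => False
  | imp φ ψ => boolVal v φ → boolVal v ψ
  | dia i φ => v (dia i φ)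

/-- Propositional tautologies (with formulas of the modal language in place of the letters). -/
def IsTautology (φ : Formula k) : Prop := ∀ v : Formula k → Prop, boolVal v φ

/-- The Gödel number of a formula. -/
def toCode : Formula k → ℕ
  | bot => 0
  | var n => (k + 2) * n + 1
  | imp φ ψ => (k + 2) * Nat.pair (toCode φ) (toCode ψ) + 1 + 1
  | dia i φ => (k + 2) * toCode φ + (i.val + 2) + 1

/-- The formula with a given Gödel number. -/
def ofCode : ℕ → Formula k
  | 0 => bot
  | N + 1 =>
    have hq : N / (k + 2) < N + 1 := Nat.lt_succ_of_le (Nat.div_le_self _ _)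
    have _h1 : (N / (k + 2)).unpair.1 < N + 1 :=
      lt_of_le_of_lt (Nat.unpair_left_le _) hq
    have _h2 : (N / (k + 2)).unpair.2 < N + 1 :=
      lt_of_le_of_lt (Nat.unpair_right_le _) hq
    if N % (k + 2) = 0 then var (N / (k + 2))
    else if N % (k + 2) = 1 then
      imp (ofCode (N / (k + 2)).unpair.1) (ofCode (N / (k + 2)).unpair.2)
    else if h : N % (k + 2) - 2 < k then dia ⟨N % (k + 2) - 2, h⟩ (ofCode (N / (k + 2)))
    else bot

theorem ofCode_toCode (φ : Formula k) : ofCode (toCode φ) = φ := by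
  have h0 : 0 < k + 2 := by omega
  induction φ with
  | var n =>
    rw [toCode, ofCode]
    simp
  | bot => rw [toCode, ofCode]
  | imp φ ψ ih1 ih2 =>
    rw [toCode, ofCode]
    have e1 : ((k + 2) * Nat.pair (toCode φ) (toCode ψ) + 1) % (k + 2) = 1 := by
      rw [Nat.mul_add_mod, Nat.mod_eq_of_lt (by omega)]
    have e2 : ((k + 2) * Nat.pair (toCode φ) (toCode ψ) + 1) / (k + 2)
        = Nat.pair (toCode φ) (toCode ψ) := by
      rw [Nat.mul_add_div h0, Nat.div_eq_of_lt (by omega), add_zero]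
    simp only [e1, e2, Nat.unpair_pair, ih1, ih2]
    simp
  | dia i φ ih =>
    rw [toCode, ofCode]
    have hi := i.isLt
    have e1 : ((k + 2) * toCode φ + (i.val + 2)) % (k + 2) = i.val + 2 := by
      rw [Nat.mul_add_mod, Nat.mod_eq_of_lt (by omega)]
    have e2 : ((k + 2) * toCode φ + (i.val + 2)) / (k + 2) = toCode φ := by
      rw [Nat.mul_add_div h0, Nat.div_eq_of_lt (by omega), add_zero]
    simp [e1, e2, ih]

theorem toCode_ofCode (N : ℕ) : toCode (ofCode N : Formula k) = N := by
  induction N using Nat.strong_induction_on with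
  | _ N ih =>
    cases N with
    | zero => rw [ofCode, toCode]
    | succ N =>
      have hq : N / (k + 2) < N + 1 := Nat.lt_succ_of_le (Nat.div_le_self _ _)
      have i1 := ih _ (lt_of_le_of_lt (Nat.unpair_left_le (N / (k + 2))) hq)
      have i2 := ih _ (lt_of_le_of_lt (Nat.unpair_right_le (N / (k + 2))) hq)
      have i3 := ih _ hq
      have hd := Nat.div_add_mod N (k + 2)
      have hm : N % (k + 2) < k + 2 := Nat.mod_lt _ (by omega)
      rw [ofCode]
      split_ifs with c1 c2 c3
      · rw [toCode]; omega
      · rw [toCode, i1, i2, Nat.pair_unpair]; omega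
      · rw [toCode, i3]
        simp only
        omega
      · omega

/-- The Gödel numbering is a bijection between formulas and natural numbers; through it, notions
of computability for sets of formulas are those of recursion theory. -/
instance instDenumerable : Denumerable (Formula k) :=
  Denumerable.mk' ⟨toCode, ofCode, ofCode_toCode, toCode_ofCode⟩

end Formula

/-! ### Kripke semantics -/

/-- Truth of a formula at a point of the model with the relations `R i` and the valuation `θ`. -/
def Truth {k : ℕ} {W : Type*} (R : Fin k → W → W → Prop) (θ : ℕ → Set W) (w : W) :
    Formula k → Prop
  | .var n => w ∈ θ n
  | .bot => False
  | .imp φ ψ => Truth R θ w φ → Truth R θ w ψ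
  | .dia i φ => ∃ v, R i w v ∧ Truth R θ v φ

/-- Validity: truth at every point under every valuation. -/
def ValidOn {k : ℕ} {W : Type*} (R : Fin k → W → W → Prop) (φ : Formula k) : Prop :=
  ∀ (θ : ℕ → Set W) (w : W), Truth R θ w φ

/-- Kripke frames with `k` relations. -/
structure Frame (k : ℕ) : Type (u + 1) where
  /-- The set of points. -/
  W : Type u
  nonempty : Nonempty W
  /-- The accessibility relations. -/
  R : Fin k → W → W → Prop

/-- The logic of a class of frames: the set of all formulas valid in all of its members. -/
def Log {k : ℕ} (C : Set (Frame.{u} k)) : Set (Formula k) :=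
  {φ | ∀ F ∈ C, ValidOn F.R φ}

/-- The frame `(W, R, R⁻¹)` for a frame `(W, R)`. -/
def Frame.tense (F : Frame.{u} 1) : Frame.{u} 2 where
  W := F.W
  nonempty := F.nonempty
  R := ![F.R 0, fun x y => F.R 0 y x]

/-- The class of the frames `(W, R, R⁻¹)` with `(W, R)` in a given class. -/
def tenseClass (C : Set (Frame.{u} 1)) : Set (Frame.{u} 2) := Frame.tense '' C

/-! ### The classes of frames -/

section Relations

variable {W : Type*}

/-- Powers of a relation. -/
def relPow (R : W → W → Prop) : ℕ → W → W → Prop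
  | 0 => Eq
  | i + 1 => Relation.Comp (relPow R i) R

/-- `R* = ⋃_{i ≤ m} R^i`. -/
def IsMTransitive (m : ℕ) (R : W → W → Prop) : Prop :=
  ∀ x y, Relation.ReflTransGen R x y ↔ ∃ i ≤ m, relPow R i x y

/-- `R^n ⊆ R^m`. -/
def IsMNRelation (m n : ℕ) (R : W → W → Prop) : Prop :=
  ∀ x y, relPow R n x y → relPow R m x y

/-- Mutual reachability; its classes are the clusters of the frame. -/
def clusterSetoid (R : W → W → Prop) : Setoid W where
  r x y := Relation.ReflTransGen R x y ∧ Relation.ReflTransGen R y x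
  iseqv :=
    { refl := fun _ => ⟨.refl, .refl⟩
      symm := fun h => ⟨h.2, h.1⟩
      trans := fun h h' => ⟨h.1.trans h'.1, h'.2.trans h.2⟩ }

/-- The set of clusters. -/
abbrev Skeleton (R : W → W → Prop) : Type _ := Quotient (clusterSetoid R)

/-- The order on clusters: `[x] ≤ [y]` if and only if `x R* y`. -/
def skeletonLE (R : W → W → Prop) (a b : Skeleton R) : Prop :=
  Quotient.liftOn₂ a b (fun x y => Relation.ReflTransGen R x y) (fun _ _ _ _ h h' =>
    propext ⟨fun g => (h.2.trans g).trans h'.1, fun g => (h.1.trans g).trans h'.2⟩)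

/-- The order `le` has height `h`: there is a chain with `h` elements, and no larger chain. -/
def HasHeight {P : Type*} (le : P → P → Prop) (h : ℕ) : Prop :=
  (∃ s : Set P, IsChain le s ∧ s.encard = h) ∧ ∀ s : Set P, IsChain le s → s.encard ≤ h

/-- The height of the frame `(W, R)`, that is, of its skeleton, is at most `h`. -/
def HeightLe (R : W → W → Prop) (h : ℕ) : Prop :=
  ∃ h' ≤ h, HasHeight (skeletonLE R) h'

end Relations

/-- The class `F(m,n,h)` of the frames of height at most `h` with `R^n ⊆ R^m`. -/
def classF (m n h : ℕ) : Set (Frame.{u} 1) :=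
  {F | IsMNRelation m n (F.R 0) ∧ HeightLe (F.R 0) h}

/-- The class `G(m,h)` of the `m`-transitive frames of height at most `h`. -/
def classG (m h : ℕ) : Set (Frame.{u} 1) :=
  {F | IsMTransitive m (F.R 0) ∧ HeightLe (F.R 0) h}

/-! ### Normal logics -/

/-- Normal propositional modal logics with `k` diamonds. -/
structure IsNormalLogic {k : ℕ} (L : Set (Formula k)) : Prop where
  taut : ∀ φ : Formula k, φ.IsTautology → φ ∈ L
  dia_bot : ∀ i : Fin k, Formula.neg (.dia i .bot) ∈ L
  dia_or : ∀ i : Fin k,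
    Formula.imp (.dia i (.or (.var 1) (.var 2))) (.or (.dia i (.var 1)) (.dia i (.var 2))) ∈ L
  modus_ponens : ∀ φ ψ : Formula k, Formula.imp φ ψ ∈ L → φ ∈ L → ψ ∈ L
  subst_mem : ∀ (σ : ℕ → Formula k) (φ : Formula k), φ ∈ L → φ.subst σ ∈ L
  monotone : ∀ (i : Fin k) (φ ψ : Formula k),
    Formula.imp φ ψ ∈ L → Formula.imp (.dia i φ) (.dia i ψ) ∈ L

/-- `K + Φ`: the least normal logic with `k` diamonds that contains `Φ`. -/
def leastLogic {k : ℕ} (Φ : Set (Formula k)) : Set (Formula k) :=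
  {φ | ∀ L : Set (Formula k), IsNormalLogic L → Φ ⊆ L → φ ∈ L}

/-- `Γ` is inconsistent with respect to `L`: the negation of the conjunction of finitely many
members of `Γ` belongs to `L`. -/
def IsInconsistent {k : ℕ} (L Γ : Set (Formula k)) : Prop :=
  ∃ l : List (Formula k), (∀ φ ∈ l, φ ∈ Γ) ∧ Formula.neg (Formula.conj l) ∈ L

/-- The `L`-maximal sets: `L`-consistent, with every proper extension `L`-inconsistent. -/
def IsMaximalSet {k : ℕ} (L Γ : Set (Formula k)) : Prop :=
  ¬ IsInconsistent L Γ ∧ ∀ Δ : Set (Formula k), Γ ⊂ Δ → IsInconsistent L Δ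

/-- The points of the canonical frame of `L`. -/
def CanonicalWorld {k : ℕ} (L : Set (Formula k)) : Type :=
  {Γ : Set (Formula k) // IsMaximalSet L Γ}

/-- The relations of the canonical frame of `L`. -/
def canonicalRel {k : ℕ} (L : Set (Formula k)) (i : Fin k) (x y : CanonicalWorld L) : Prop :=
  ∀ φ ∈ y.1, Formula.dia i φ ∈ x.1

/-- Canonical logics: consistent normal logics that are valid in their canonical frames. -/
def IsCanonical {k : ℕ} (L : Set (Formula k)) : Prop :=
  IsNormalLogic L ∧ Formula.bot ∉ L ∧ ∀ φ ∈ L, ValidOn (canonicalRel L) φ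

/-! ### The axioms -/

/-- The formulas `B_h(m)`, `h ≥ 1`, of bounded height, with `B_1(m) = p_1 → □^{≤m} ◇^{≤m} p_1` and
`B_{h+1}(m) = p_{h+1} → □^{≤m} (◇^{≤m} p_{h+1} ∨ B_h(m))`. The value at `h = 0` is not used. -/
def heightFormula (m : ℕ) : ℕ → Formula 1
  | 0 => .bot
  | 1 => .imp (.var 1) (.boxLe 0 m (.diaLe 0 m (.var 1)))
  | h + 2 => .imp (.var (h + 2))
      (.boxLe 0 m (.or (.diaLe 0 m (.var (h + 2))) (heightFormula m (h + 1))))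

/-- The axioms `◇^n p → ◇^m p` and `B_h(n-1)`. -/
def axiomsF (m n h : ℕ) : Set (Formula 1) :=
  {.imp (.diaPow 0 n (.var 0)) (.diaPow 0 m (.var 0)), heightFormula (n - 1) h}

/-- The axioms `◇^{m+1} p → ◇^{≤m} p` and `B_h(m)`. -/
def axiomsG (m h : ℕ) : Set (Formula 1) :=
  {.imp (.diaPow 0 (m + 1) (.var 0)) (.diaLe 0 m (.var 0)), heightFormula m h}

/-- A unimodal formula read as a bimodal one, with the first of the two diamonds. -/
def toFirst : Formula 1 → Formula 2
  | .var n => .var n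
  | .bot => .bot
  | .imp φ ψ => .imp (toFirst φ) (toFirst ψ)
  | .dia _ φ => .dia 0 (toFirst φ)

/-- The two converse axioms `p → ¬◇₁¬◇₂p` and `p → ¬◇₂¬◇₁p`. -/
def converseAxioms : Set (Formula 2) :=
  {.imp (.var 0) (.neg (.dia 0 (.neg (.dia 1 (.var 0))))),
   .imp (.var 0) (.neg (.dia 1 (.neg (.dia 0 (.var 0)))))}

/-- The least normal bimodal logic that contains the unimodal logic `L`, for the first diamond,
and the two converse axioms. -/
def tenseExtension (L : Set (Formula 1)) : Set (Formula 2) :=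
  leastLogic (toFirst '' L ∪ converseAxioms)

end Modal

/-! Decidability rests on a finite model property with a computable size bound. Take a model on a
frame of the class refuting `φ` and partition its points by the truth of all formulas with codes up
to that of `φ`. The least filtration on any finer partition preserves these truth values, and it
treats `R` and its converse alike: the converse of the least quotient relation is the least quotient
relation of the converse. What has to be secured is that the quotient frame stays in the class.

For this the partition is refined until it is tuned for the relation "in a positive number of steps
congruent to 1 modulo `e`", with `e = n - m` for `classF` and `e = 1` for `classG`. A path of length
`k` in the quotient then lifts to one of length `k + t * e` (`exists_relPow_of_quotRel`). Such
lengthening is harmless: `R^n ⊆ R^m` absorbs multiples of `n - m`, and `m`-transitivity does not see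
lengths beyond `m`. Bounds on the height survive as well.

A finite tuned refinement exists because inside a cluster a path of residue `j` can be reversed with
residue `-j`. Hence what is reached from one point of a cluster is a shift of what is reached from
another, and splitting classes by what they reach stabilizes after one round per rank
(`refine_stable`). Height at most `h` gives at most `h` rounds. Validity of the two axioms decides
whether a finite frame is in the class, so a bounded search decides the tense logic.

For axiomatization and canonicity, the refutations of the axioms on frames outside the class use
only valuations by sets that separate points from `j`-step neighbourhoods. In a canonical frame the
definable sets are such a family, and every axiom holds under definable valuations, so the canonical
frame belongs to the class. In the tense extension the converse axioms make the two canonical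
relations mutually converse, and the same argument applies to the first of them. -/

namespace Modal

/-! ### Powers of a relation -/

section Relations

variable {W : Type*} {R : W → W → Prop}

theorem relPow_trans {i : ℕ} {x y : W} (hxy : relPow R i x y) :
    ∀ {j : ℕ} {z : W}, relPow R j y z → relPow R (i + j) x z
  | 0, _, h => by cases h; exact hxy
  | _ + 1, _, ⟨w, hw, hz⟩ => ⟨w, relPow_trans hxy hw, hz⟩

theorem relPow_add_iff {i : ℕ} {x z : W} :
    ∀ {j : ℕ}, relPow R (i + j) x z ↔ ∃ y, relPow R i x y ∧ relPow R j y z := by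
  intro j
  refine ⟨fun h => ?_, fun ⟨y, h, h'⟩ => relPow_trans h h'⟩
  induction j generalizing z with
  | zero => exact ⟨z, h, rfl⟩
  | succ j ih =>
    obtain ⟨w, hw, hz⟩ := h
    obtain ⟨y, hy, hyw⟩ := ih hw
    exact ⟨y, hy, w, hyw, hz⟩

theorem relPow_one {x y : W} : relPow R 1 x y ↔ R x y :=
  ⟨fun ⟨_, h, h'⟩ => by cases h; exact h', fun h => ⟨x, rfl, h⟩⟩

theorem relPow_succ_left {j : ℕ} {x z : W} :
    relPow R (j + 1) x z ↔ ∃ y, R x y ∧ relPow R j y z := by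
  rw [add_comm, relPow_add_iff]
  simp only [relPow_one]

theorem reflTransGen_iff_relPow {x y : W} :
    Relation.ReflTransGen R x y ↔ ∃ k, relPow R k x y := by
  constructor
  · intro h
    induction h with
    | refl => exact ⟨0, rfl⟩
    | tail _ h ih => exact ih.elim fun k hk => ⟨k + 1, _, hk, h⟩
  · rintro ⟨k, hk⟩
    induction k generalizing y with
    | zero => cases hk; exact .refl
    | succ k ih => obtain ⟨w, hw, hy⟩ := hk; exact (ih hw).tail hy

theorem relPow_mul_of_loop {x : W} {c : ℕ} (h : relPow R c x x) (t : ℕ) :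
    relPow R (t * c) x x := by
  induction t with
  | zero => rw [zero_mul]; exact rfl
  | succ t ih => rw [add_mul, one_mul]; exact relPow_trans ih h

theorem isMTransitive_of_succ {m : ℕ}
    (h : ∀ x y, relPow R (m + 1) x y → ∃ i ≤ m, relPow R i x y) : IsMTransitive m R := by
  intro x y
  refine ⟨fun hxy => ?_, fun ⟨i, _, hi⟩ => reflTransGen_iff_relPow.2 ⟨i, hi⟩⟩
  induction hxy with
  | refl => exact ⟨0, Nat.zero_le _, rfl⟩
  | tail _ hR ih =>
    obtain ⟨i, hi, hxi⟩ := ih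
    rcases hi.lt_or_eq with hlt | rfl
    · exact ⟨i + 1, hlt, _, hxi, hR⟩
    · exact h _ _ ⟨_, hxi, hR⟩

theorem IsMNRelation.isMTransitive {m n : ℕ} (hmn : m < n) (h : IsMNRelation m n R) :
    IsMTransitive (n - 1) R :=
  isMTransitive_of_succ fun x y hxy =>
    ⟨m, by omega, h x y (by rwa [Nat.sub_add_cancel (by omega)] at hxy)⟩

/-- Replacing the first `n` steps by `m` shortens a path by `n - m`; iterate. -/
theorem IsMNRelation.relPow_of_add_mul {m n : ℕ} (hmn : m < n) (h : IsMNRelation m n R) {x y : W}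
    {t : ℕ} (hxy : relPow R (m + t * (n - m)) x y) : relPow R m x y := by
  induction t generalizing x with
  | zero => simpa using hxy
  | succ t ih =>
    have e : m + (t + 1) * (n - m) = n + t * (n - m) := by
      rw [add_mul]; omega
    rw [e, relPow_add_iff] at hxy
    obtain ⟨z, hz, hzy⟩ := hxy
    exact ih (relPow_trans (h _ _ hz) hzy)

/-! ### Depth of points and height -/

/-- A strictly increasing sequence of `j + 1` clusters starts at the cluster of `x`. -/
def DepthAtLeast (R : W → W → Prop) : ℕ → W → Prop
  | 0, _ => True
  | j + 1, x => ∃ y, Relation.ReflTransGen R x y ∧ ¬ Relation.ReflTransGen R y x ∧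
      DepthAtLeast R j y

theorem DepthAtLeast.mono_left {j : ℕ} {x y : W} (hxy : Relation.ReflTransGen R x y)
    (h : DepthAtLeast R j y) : DepthAtLeast R j x := by
  cases j with
  | zero => trivial
  | succ j =>
    obtain ⟨z, hz, hzy, hd⟩ := h
    exact ⟨z, hxy.trans hz, fun g => hzy (g.trans hxy), hd⟩

theorem DepthAtLeast.pred {j : ℕ} {x : W} (h : DepthAtLeast R (j + 1) x) : DepthAtLeast R j x :=
  h.elim fun _ h => h.2.2.mono_left h.1

theorem DepthAtLeast.anti {i j : ℕ} (hij : i ≤ j) {x : W} (h : DepthAtLeast R j x) :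
    DepthAtLeast R i x := by
  induction hij with
  | refl => exact h
  | step _ ih => exact ih h.pred

/-- In a frame of finite height the points can be ranked. -/
theorem exists_rank {h : ℕ} (hR : ∀ x, ¬ DepthAtLeast R h x) :
    ∃ d : W → ℕ, (∀ x, d x < h) ∧ (∀ x y, Relation.ReflTransGen R x y → d y ≤ d x) ∧
      ∀ x y, Relation.ReflTransGen R x y → d x ≤ d y → Relation.ReflTransGen R y x := by
  classical
  have key : ∀ x, DepthAtLeast R (Nat.findGreatest (fun j => DepthAtLeast R j x) h) x := fun x =>
    Nat.findGreatest_spec (P := fun j => DepthAtLeast R j x) (Nat.zero_le h) trivial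
  have hlt : ∀ x j, DepthAtLeast R j x → j < h := fun x j hj =>
    not_le.1 fun hle => hR x (hj.anti hle)
  have hle : ∀ x j, DepthAtLeast R j x → j ≤ Nat.findGreatest (fun j => DepthAtLeast R j x) h :=
    fun x j hj => Nat.le_findGreatest (hlt x j hj).le hj
  refine ⟨fun x => Nat.findGreatest (fun j => DepthAtLeast R j x) h, fun x => hlt x _ (key x),
    fun x y hxy => hle x _ ((key y).mono_left hxy), fun x y hxy hd => ?_⟩
  by_contra hyx
  -- Without a way back, a longest ascent from `y` could be prolonged by `x`, so the rank of `x`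
  -- would exceed that of `y`.
  have hx : DepthAtLeast R (_ + 1) x := ⟨y, hxy, hyx, key y⟩
  exact absurd (hle x _ hx) (not_le.2 (Nat.lt_succ_of_le hd))

/-! ### Chains of clusters versus depth of points -/

theorem skeletonLE_antisymm {a b : Skeleton R} (h : skeletonLE R a b) (h' : skeletonLE R b a) :
    a = b := by
  induction a using Quotient.ind
  induction b using Quotient.ind
  exact Quotient.sound ⟨h, h'⟩

theorem skeletonLE_trans {a b c : Skeleton R} (h : skeletonLE R a b) (h' : skeletonLE R b c) :
    skeletonLE R a c := by
  induction a using Quotient.ind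
  induction b using Quotient.ind
  induction c using Quotient.ind
  exact Relation.ReflTransGen.trans h h'

theorem DepthAtLeast.exists_chain {j : ℕ} {x : W} (h : DepthAtLeast R j x) :
    ∃ s : Set (Skeleton R), IsChain (skeletonLE R) s ∧ s.encard = (j + 1 : ℕ) ∧
      ∀ a ∈ s, skeletonLE R (Quotient.mk _ x) a := by
  induction j generalizing x with
  | zero =>
    refine ⟨{Quotient.mk _ x}, IsChain.singleton, by simp, ?_⟩
    rintro a rfl
    exact .refl
  | succ j ih =>
    obtain ⟨y, hxy, hyx, hy⟩ := h
    obtain ⟨s, hs, hcard, hmin⟩ := ih hy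
    have hle : ∀ a ∈ s, skeletonLE R (Quotient.mk _ x) a := fun a ha =>
      skeletonLE_trans (b := Quotient.mk _ y) hxy (hmin a ha)
    refine ⟨insert (Quotient.mk _ x) s, hs.insert fun a ha _ => Or.inl (hle a ha), ?_, ?_⟩
    · rw [Set.encard_insert_of_notMem, hcard]
      · norm_cast
      · exact fun hx => hyx (hmin _ hx)
    · rintro a (rfl | ha)
      · exact .refl
      · exact hle a ha

/-- The least cluster of a finite chain lies strictly below the remaining ones, which carry an
ascent by induction. -/
theorem exists_depthAtLeast_of_chain {j : ℕ} {t : Finset (Skeleton R)}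
    (ht : IsChain (skeletonLE R) (t : Set (Skeleton R))) (hcard : t.card = j + 1) :
    ∃ x, Quotient.mk _ x ∈ t ∧ DepthAtLeast R j x := by
  classical
  induction j generalizing t with
  | zero =>
    obtain ⟨a, ha⟩ := Finset.card_pos.1 (by omega : 0 < t.card)
    induction a using Quotient.ind with
    | _ x => exact ⟨x, ha, trivial⟩
  | succ j ih =>
    let P : PartialOrder (Skeleton R) :=
      { le := skeletonLE R
        le_refl := fun a => by induction a using Quotient.ind; exact .refl
        le_trans := fun _ _ _ => skeletonLE_trans
        le_antisymm := fun _ _ => skeletonLE_antisymm }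
    obtain ⟨a, ha⟩ := t.exists_minimal (Finset.card_pos.1 (by omega))
    obtain ⟨y, hy, hd⟩ := ih (t := t.erase a) (ht.mono (by simp)) (by
      rw [Finset.card_erase_of_mem ha.1, hcard]; rfl)
    rw [Finset.mem_erase] at hy
    induction a using Quotient.ind with
    | _ x =>
      have hxy : skeletonLE R (Quotient.mk _ x) (Quotient.mk _ y) := by
        rcases ht ha.1 hy.2 hy.1.symm with h | h
        · exact h
        · exact ha.2 hy.2 h
      exact ⟨x, ha.1, y, hxy, fun hyx => hy.1 (skeletonLE_antisymm hyx hxy), hd⟩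

/-- This turns a condition on chains in the skeleton into one on ascents from points. A chain that
is too large, possibly infinite, is cut down to one with exactly `h + 1` clusters. -/
theorem heightLe_iff {h : ℕ} : HeightLe R h ↔ ∀ x, ¬ DepthAtLeast R h x := by
  classical
  constructor
  · rintro ⟨h', hh', -, hmax⟩ x hx
    obtain ⟨s, hs, hcard, -⟩ := hx.exists_chain
    have := hmax s hs
    rw [hcard] at this
    norm_cast at this
    omega
  · intro hR
    have hbound : ∀ s : Set (Skeleton R), IsChain (skeletonLE R) s → s.encard ≤ h := by
      intro s hs
      by_contra hlt
      have h1 : ((h + 1 : ℕ) : ℕ∞) ≤ s.encard := by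
        push_cast
        exact Order.add_one_le_of_lt (not_le.1 hlt)
      obtain ⟨t, hts, htc⟩ := Set.exists_subset_encard_eq h1
      have hfin : t.Finite := Set.finite_of_encard_eq_coe htc
      obtain ⟨x, -, hx⟩ := exists_depthAtLeast_of_chain (j := h) (t := hfin.toFinset)
        (by simpa using hs.mono hts) (by
          rw [hfin.encard_eq_coe_toFinset_card] at htc
          exact_mod_cast htc)
      exact hR x hx
    let Q : ℕ → Prop := fun j => ∃ s : Set (Skeleton R), IsChain (skeletonLE R) s ∧ s.encard = j
    have h0 : Q 0 := ⟨∅, by simp, by simp⟩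
    refine ⟨Nat.findGreatest Q h, Nat.findGreatest_le h,
      Nat.findGreatest_spec (Nat.zero_le h) h0, fun s hs => ?_⟩
    have hle := hbound s hs
    obtain ⟨j, hj⟩ := ENat.ne_top_iff_exists.1 (ne_top_of_le_ne_top (ENat.natCast_ne_top h) hle)
    rw [← hj] at hle ⊢
    norm_cast at hle ⊢
    exact Nat.le_findGreatest hle ⟨s, hs, hj.symm⟩

/-! ### Tuned partitions -/

/-- Accessibility in a positive number of steps of residue `j` modulo `e`. -/
def stepsMod (e : ℕ) (R : W → W → Prop) (j : ZMod e) (x y : W) : Prop :=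
  ∃ k : ℕ, 1 ≤ k ∧ (k : ZMod e) = j ∧ relPow R k x y

theorem stepsMod_trans {e : ℕ} {i j : ZMod e} {x y z : W} (h : stepsMod e R i x y)
    (h' : stepsMod e R j y z) : stepsMod e R (i + j) x z := by
  obtain ⟨k, hk, rfl, hxy⟩ := h
  obtain ⟨l, hl, rfl, hyz⟩ := h'
  exact ⟨k + l, by omega, by push_cast; rfl, relPow_trans hxy hyz⟩

theorem stepsMod.reflTransGen {e : ℕ} {j : ZMod e} {x y : W} (h : stepsMod e R j x y) :
    Relation.ReflTransGen R x y :=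
  h.elim fun k hk => reflTransGen_iff_relPow.2 ⟨k, hk.2.2⟩

/-- Going back inside a cluster. -/
theorem stepsMod.neg {e : ℕ} (he : 1 ≤ e) {j : ZMod e} {x y : W} (h : stepsMod e R j x y)
    (hyx : Relation.ReflTransGen R y x) : stepsMod e R (-j) y x := by
  obtain ⟨k, hk, rfl, hxy⟩ := h
  obtain ⟨l, hl⟩ := reflTransGen_iff_relPow.1 hyx
  have hloop := relPow_mul_of_loop (relPow_trans hxy hl) (2 * e - 1)
  -- The way back is followed by `2e - 1` rounds of the loop at `x`, so that the round trip from `x`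
  -- has length divisible by `e`. With `e - 1` rounds the return could be empty when `e = 1` and `l
  -- = 0`.
  have e1 : k + (l + (2 * e - 1) * (k + l)) = 2 * e * (k + l) := by
    obtain ⟨f, rfl⟩ : ∃ f, e = f + 1 := ⟨e - 1, by omega⟩
    have : 2 * (f + 1) - 1 = 2 * f + 1 := by omega
    rw [this]; ring
  refine ⟨l + (2 * e - 1) * (k + l), ?_, ?_, relPow_trans hl hloop⟩
  · have : 1 * 1 ≤ (2 * e - 1) * (k + l) := Nat.mul_le_mul (by omega) (by omega)
    omega
  · have := congrArg (Nat.cast : ℕ → ZMod e) e1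
    push_cast at this
    rw [eq_neg_iff_add_eq_zero, add_comm]
    push_cast
    rw [this]
    simp

/-- This is the shift property of clusters: prefixing a reversible path of residue `j` only
translates the residues. -/
theorem stepsMod_shift {e : ℕ} {j : ZMod e} {x y : W} (h : stepsMod e R j x y)
    (h' : stepsMod e R (-j) y x) (l : ZMod e) (z : W) :
    stepsMod e R l y z ↔ stepsMod e R (j + l) x z :=
  ⟨fun g => stepsMod_trans h g, fun g => by simpa using stepsMod_trans h' g⟩

/-- The classes, under `s`, that are reached from a point. -/
def reached {ι : Type*} (T : ι → W → W → Prop) (s : Setoid W) (x : W) : Set (ι × Quotient s) :=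
  {p | ∃ y, T p.1 x y ∧ Quotient.mk s y = p.2}

/-- Points of a class of `s` are told apart by the classes they reach. -/
def refine {ι : Type*} (T : ι → W → W → Prop) (s : Setoid W) : Setoid W :=
  Setoid.ker fun x => (Quotient.mk s x, reached T s x)

theorem refine_rel {ι : Type*} {T : ι → W → W → Prop} {s : Setoid W} {x y : W} :
    refine T s x y ↔ s x y ∧ reached T s x = reached T s y := by
  rw [refine, Setoid.ker_def, Prod.mk.injEq, Quotient.eq]

theorem refine_iterate_le {ι : Type*} (T : ι → W → W → Prop) (s : Setoid W) (i : ℕ) :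
    (refine T)^[i] s ≤ s := by
  induction i with
  | zero => exact le_rfl
  | succ i ih =>
    rw [Function.iterate_succ_apply']
    exact fun x y h => ih (refine_rel.1 h).1

/-! ### Counting the classes of refinements -/

theorem card_quotient_ker_le {α : Type*} [Finite α] (f : W → α) :
    Finite (Quotient (Setoid.ker f)) ∧ Nat.card (Quotient (Setoid.ker f)) ≤ Nat.card α :=
  ⟨Finite.of_injective _ (Setoid.kerLift_injective f),
    Nat.card_le_card_of_injective _ (Setoid.kerLift_injective f)⟩

theorem card_refine_le {ι : Type*} [Finite ι] (T : ι → W → W → Prop) (s : Setoid W)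
    [Finite (Quotient s)] {N : ℕ} (hN : Nat.card (Quotient s) ≤ N) :
    Finite (Quotient (refine T s)) ∧
      Nat.card (Quotient (refine T s)) ≤ N * 2 ^ (Nat.card ι * N) := by
  have h := card_quotient_ker_le fun x => (Quotient.mk s x, reached T s x)
  refine ⟨h.1, h.2.trans ?_⟩
  have hset : Nat.card (Set (ι × Quotient s)) = 2 ^ (Nat.card ι * Nat.card (Quotient s)) := by
    rw [← Nat.card_prod]
    have := Fintype.ofFinite (ι × Quotient s)
    simp [Nat.card_eq_fintype_card]
  rw [Nat.card_prod, hset]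
  gcongr
  norm_num

theorem card_refine_iterate_le {ι : Type*} [Finite ι] (T : ι → W → W → Prop) (s : Setoid W)
    [Finite (Quotient s)] {N : ℕ} (hN : Nat.card (Quotient s) ≤ N) (i : ℕ) :
    Finite (Quotient ((refine T)^[i] s)) ∧
      Nat.card (Quotient ((refine T)^[i] s)) ≤ (fun N => N * 2 ^ (Nat.card ι * N))^[i] N := by
  induction i with
  | zero => exact ⟨‹_›, hN⟩
  | succ i ih =>
    simp only [Function.iterate_succ_apply']
    have := ih.1
    exact card_refine_le T _ ih.2

/-- In a frame of finite height, refinement of a partition that respects the rank stabilizes. -/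
theorem refine_stable {e : ℕ} (he : 1 ≤ e) {s : Setoid W} {d : W → ℕ}
    (hd : ∀ x y, Relation.ReflTransGen R x y → d y ≤ d x)
    (hd' : ∀ x y, Relation.ReflTransGen R x y → d x ≤ d y → Relation.ReflTransGen R y x)
    (hs : ∀ x y, s x y → d x = d y) (i : ℕ) (x x' : W) (hx : d x < i)
    (h : (refine (stepsMod e R))^[i] s x x') : (refine (stepsMod e R))^[i + 1] s x x' := by
  induction i generalizing x x' with
  | zero => omega
  | succ i ih =>
    have aux : ∀ x x', d x < i + 1 → (refine (stepsMod e R))^[i + 1] s x x' →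
        reached (stepsMod e R) ((refine (stepsMod e R))^[i + 1] s) x ⊆
          reached (stepsMod e R) ((refine (stepsMod e R))^[i + 1] s) x' := by
      rintro x x' hx h ⟨j, _⟩ ⟨y, hxy : stepsMod e R j x y, rfl⟩
      have hdx := hs _ _ (refine_iterate_le _ s _ h)
      rw [Function.iterate_succ_apply'] at h
      have hr := (refine_rel.1 h).2
      -- One round of refinement matches `y` with some `y'` only up to the previous partition; the
      -- remaining task is to gain one more round.
      obtain ⟨y', hxy', hyy'⟩ := (Set.ext_iff.1 hr (j, Quotient.mk _ y)).1 ⟨y, hxy, rfl⟩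
      change stepsMod e R j x' y' at hxy'
      have hyy : (refine (stepsMod e R))^[i] s y y' := Setoid.symm' _ (Quotient.exact hyy')
      have hdy := hs _ _ (refine_iterate_le _ s _ hyy)
      refine ⟨y', hxy', Quotient.sound (Setoid.symm' _ ?_)⟩
      -- Points of lower rank are settled by induction. Otherwise `y` has the rank of `x`, hence
      -- lies in its cluster, and likewise `y'` for `x'`. The classes reached from `y` and `y'` are
      -- then the same shift of those reached from `x` and `x'`, which agree.
      by_cases hy : d y < i
      · exact ih y y' hy hyy
      · have hle := hd _ _ hxy.reflTransGen
        have b := stepsMod_shift hxy (hxy.neg he (hd' _ _ hxy.reflTransGen (by omega)))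
        have b' := stepsMod_shift hxy' (hxy'.neg he (hd' _ _ hxy'.reflTransGen (by omega)))
        change ((refine (stepsMod e R))^[i + 1] s) y y'
        rw [Function.iterate_succ_apply']
        refine refine_rel.2 ⟨hyy, ?_⟩
        ext ⟨l, q⟩
        have := Set.ext_iff.1 hr (j + l, q)
        simp only [reached, Set.mem_ofPred_eq] at this ⊢
        simpa only [b, b'] using this
    rw [Function.iterate_succ_apply']
    have hx' : d x' < i + 1 := by rwa [← hs _ _ (refine_iterate_le _ s _ h)]
    exact refine_rel.2 ⟨h, (aux x x' hx h).antisymm (aux x' x hx' (Setoid.symm' _ h))⟩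

/-- The bound on the number of classes in tuned refinements. -/
def tunedBound (h e N : ℕ) : ℕ := (fun N => N * 2 ^ (e * N))^[h] (N * h)

/-- A partition is tuned if related classes are connected from each of their points. -/
def IsTuned (T : W → W → Prop) (s : Setoid W) : Prop :=
  ∀ x x' y, s x x' → T x y → ∃ y', T x' y' ∧ s y y'

/-- A finite partition of a frame of finite height has a finite tuned refinement. -/
theorem exists_tuned_refinement {h e : ℕ} (he : 1 ≤ e) (hR : ∀ x, ¬ DepthAtLeast R h x)
    {α : Type*} [Finite α] (f : W → α) :
    ∃ s : Setoid W, (∀ x y, s x y → f x = f y) ∧ IsTuned (stepsMod e R 1) s ∧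
      Finite (Quotient s) ∧ Nat.card (Quotient s) ≤ tunedBound h e (Nat.card α) := by
  obtain ⟨d, hlt, hd, hd'⟩ := exists_rank hR
  have : NeZero e := ⟨by omega⟩
  -- The rank is recorded from the start, as `refine_stable` needs; this is the factor `h` in
  -- `tunedBound`. As all ranks are below `h`, `h` rounds suffice.
  let s₀ : Setoid W := Setoid.ker fun x => (f x, (⟨d x, hlt x⟩ : Fin h))
  have hs₀ : ∀ x y, s₀ x y → f x = f y ∧ d x = d y := fun x y hxy => by
    simpa [s₀, Setoid.ker_def] using hxy
  have hcard := card_quotient_ker_le fun x => (f x, (⟨d x, hlt x⟩ : Fin h))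
  have := hcard.1
  have hN : Nat.card (Quotient s₀) ≤ Nat.card α * h := by simpa using hcard.2
  have hfin := card_refine_iterate_le (stepsMod e R) s₀ hN h
  refine ⟨(refine (stepsMod e R))^[h] s₀,
    fun x y hxy => (hs₀ x y (refine_iterate_le _ _ _ hxy)).1, fun x x' y hxx hxy => ?_, hfin.1, ?_⟩
  · have h1 := refine_stable he hd hd' (fun x y h => (hs₀ x y h).2) h x x' (hlt x) hxx
    rw [Function.iterate_succ_apply'] at h1
    obtain ⟨y', hy', hyy⟩ :=
      (Set.ext_iff.1 (refine_rel.1 h1).2 (1, Quotient.mk _ y)).1 ⟨y, hxy, rfl⟩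
    exact ⟨y', hy', Setoid.symm' _ (Quotient.exact hyy)⟩
  · simpa [tunedBound] using hfin.2

/-! ### Quotients by tuned partitions -/

/-- The least relation on the classes for which the projection is monotone. -/
def quotRel (s : Setoid W) (R : W → W → Prop) (a b : Quotient s) : Prop :=
  ∃ x y, Quotient.mk s x = a ∧ Quotient.mk s y = b ∧ R x y

theorem relPow_quotRel {s : Setoid W} {k : ℕ} {x y : W} (h : relPow R k x y) :
    relPow (quotRel s R) k (Quotient.mk s x) (Quotient.mk s y) := by
  induction k generalizing y with
  | zero => cases h; exact rfl
  | succ k ih => obtain ⟨z, hz, hzy⟩ := h; exact ⟨_, ih hz, z, y, rfl, rfl, hzy⟩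

/-- An edge of the quotient starts at some representative `u`, not necessarily at the point `z`
already reached. Tunedness replaces it by a path from `z` of length congruent to 1. Since that
length is positive, it is 1 plus a natural multiple of `e`, even for `e = 1`. -/
theorem exists_relPow_of_quotRel {e : ℕ} {s : Setoid W} (hs : IsTuned (stepsMod e R 1) s) {k : ℕ}
    {x : W} {b : Quotient s} (h : relPow (quotRel s R) k (Quotient.mk s x) b) :
    ∃ y t, Quotient.mk s y = b ∧ relPow R (k + t * e) x y := by
  induction k generalizing b with
  | zero => exact ⟨x, 0, h, by rw [zero_mul]; exact rfl⟩
  | succ k ih =>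
    obtain ⟨a, ha, u, v, rfl, rfl, huv⟩ := h
    obtain ⟨z, t, hz, hxz⟩ := ih ha
    obtain ⟨y, ⟨l, hl, hl1, hzy⟩, hvy⟩ := hs u z v (Setoid.symm (Quotient.exact hz))
      ⟨1, le_rfl, Nat.cast_one, relPow_one.2 huv⟩
    have hdvd : e ∣ l - 1 := by
      rw [← ZMod.natCast_eq_zero_iff, Nat.cast_sub hl, hl1, Nat.cast_one, sub_self]
    obtain ⟨t', ht'⟩ := hdvd
    refine ⟨y, t + t', Quotient.sound (Setoid.symm hvy), ?_⟩
    have := relPow_trans hxz hzy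
    rwa [show k + t * e + l = k + 1 + (t + t') * e by
      rw [show l = e * t' + 1 by omega]; ring] at this

theorem exists_reflTransGen_of_quotRel {e : ℕ} {s : Setoid W} (hs : IsTuned (stepsMod e R 1) s)
    {x : W} {b : Quotient s} (h : Relation.ReflTransGen (quotRel s R) (Quotient.mk s x) b) :
    ∃ y, Quotient.mk s y = b ∧ Relation.ReflTransGen R x y := by
  obtain ⟨k, hk⟩ := reflTransGen_iff_relPow.1 h
  obtain ⟨y, t, hy, hxy⟩ := exists_relPow_of_quotRel hs hk
  exact ⟨y, hy, reflTransGen_iff_relPow.2 ⟨_, hxy⟩⟩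

/-- Ascents lift along paths, and stay strict because a way back would project to the quotient. -/
theorem DepthAtLeast.of_quotRel {e : ℕ} {s : Setoid W} (hs : IsTuned (stepsMod e R 1) s) {j : ℕ}
    {x : W} (h : DepthAtLeast (quotRel s R) j (Quotient.mk s x)) : DepthAtLeast R j x := by
  induction j generalizing x with
  | zero => trivial
  | succ j ih =>
    obtain ⟨b, hb, hbx, hd⟩ := h
    obtain ⟨y, rfl, hxy⟩ := exists_reflTransGen_of_quotRel hs hb
    refine ⟨y, hxy, fun hyx => hbx ?_, ih hd⟩
    obtain ⟨k, hk⟩ := reflTransGen_iff_relPow.1 hyx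
    exact reflTransGen_iff_relPow.2 ⟨k, relPow_quotRel hk⟩

theorem HeightLe.quotRel {e h : ℕ} {s : Setoid W} (hs : IsTuned (stepsMod e R 1) s)
    (hR : HeightLe R h) : HeightLe (quotRel s R) h := by
  rw [heightLe_iff] at hR ⊢
  intro a
  induction a using Quotient.ind with
  | _ x => exact fun hx => hR x (hx.of_quotRel hs)

theorem IsMNRelation.quotRel {m n : ℕ} (hmn : m < n) {s : Setoid W}
    (hs : IsTuned (stepsMod (n - m) R 1) s) (hR : IsMNRelation m n R) :
    IsMNRelation m n (quotRel s R) := by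
  intro a b hab
  induction a using Quotient.ind with
  | _ x =>
    obtain ⟨y, t, rfl, hxy⟩ := exists_relPow_of_quotRel hs hab
    -- The lifted path has length `n + t(n - m) = m + (t + 1)(n - m)`.
    refine relPow_quotRel (hR.relPow_of_add_mul hmn (t := t + 1) ?_)
    rwa [show m + (t + 1) * (n - m) = n + t * (n - m) by rw [add_mul]; omega]

theorem IsMTransitive.quotRel {e m : ℕ} {s : Setoid W} (hs : IsTuned (stepsMod e R 1) s)
    (hR : IsMTransitive m R) : IsMTransitive m (quotRel s R) := by
  refine isMTransitive_of_succ fun a b hab => ?_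
  induction a using Quotient.ind with
  | _ x =>
    obtain ⟨y, t, rfl, hxy⟩ := exists_relPow_of_quotRel hs hab
    obtain ⟨i, hi, hxi⟩ := (hR x y).1 (reflTransGen_iff_relPow.2 ⟨_, hxy⟩)
    exact ⟨i, hi, relPow_quotRel hxi⟩

end Relations

/-! ### Truth of the abbreviations -/

section Truth

variable {k : ℕ} {W : Type*} {R : Fin k → W → W → Prop} {θ : ℕ → Set W} {w : W}
  {φ ψ : Formula k} {i : Fin k}

theorem truth_neg : Truth R θ w φ.neg ↔ ¬ Truth R θ w φ := Iff.rfl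

theorem truth_or : Truth R θ w (φ.or ψ) ↔ Truth R θ w φ ∨ Truth R θ w ψ := by
  simp only [Formula.or, Truth, truth_neg]
  tauto

theorem truth_and : Truth R θ w (φ.and ψ) ↔ Truth R θ w φ ∧ Truth R θ w ψ := by
  simp only [Formula.and, Truth, truth_neg]
  tauto

theorem truth_box : Truth R θ w (φ.box i) ↔ ∀ v, R i w v → Truth R θ v φ := by
  simp only [Formula.box, Truth, truth_neg]
  push Not
  rfl

theorem truth_diaPow {j : ℕ} :
    Truth R θ w (φ.diaPow i j) ↔ ∃ v, relPow (R i) j w v ∧ Truth R θ v φ := by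
  induction j generalizing w with
  | zero => exact ⟨fun h => ⟨w, rfl, h⟩, fun ⟨v, hv, h⟩ => by cases hv; exact h⟩
  | succ j ih =>
    simp only [Formula.diaPow, Truth, ih, relPow_succ_left]
    exact ⟨fun ⟨y, hy, v, hv, h⟩ => ⟨v, ⟨y, hy, hv⟩, h⟩, fun ⟨v, ⟨y, hy, hv⟩, h⟩ => ⟨y, hy, v, hv, h⟩⟩

theorem truth_boxPow {j : ℕ} :
    Truth R θ w (φ.boxPow i j) ↔ ∀ v, relPow (R i) j w v → Truth R θ v φ := by
  induction j generalizing w with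
  | zero => exact ⟨fun h v hv => by cases hv; exact h, fun h => h w rfl⟩
  | succ j ih =>
    simp only [Formula.boxPow, truth_box, ih, relPow_succ_left]
    exact ⟨fun h v ⟨y, hy, hv⟩ => h y hy v hv, fun h y hy v hv => h v ⟨y, hy, hv⟩⟩

theorem truth_diaLe {m : ℕ} :
    Truth R θ w (φ.diaLe i m) ↔ ∃ v, (∃ j ≤ m, relPow (R i) j w v) ∧ Truth R θ v φ := by
  induction m with
  | zero =>
    simp only [Nat.le_zero, exists_eq_left, Formula.diaLe]
    exact truth_diaPow (j := 0)
  | succ m ih =>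
    rw [Formula.diaLe, truth_or, ih, truth_diaPow]
    constructor
    · rintro (⟨v, ⟨j, hj, hv⟩, h⟩ | ⟨v, hv, h⟩)
      · exact ⟨v, ⟨j, by omega, hv⟩, h⟩
      · exact ⟨v, ⟨m + 1, le_rfl, hv⟩, h⟩
    · rintro ⟨v, ⟨j, hj, hv⟩, h⟩
      rcases hj.lt_or_eq with hlt | rfl
      · exact Or.inl ⟨v, ⟨j, by omega, hv⟩, h⟩
      · exact Or.inr ⟨v, hv, h⟩

theorem truth_boxLe {m : ℕ} :
    Truth R θ w (φ.boxLe i m) ↔ ∀ v, (∃ j ≤ m, relPow (R i) j w v) → Truth R θ v φ := by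
  induction m with
  | zero =>
    simp only [Nat.le_zero, exists_eq_left, Formula.boxLe]
    exact truth_boxPow (j := 0)
  | succ m ih =>
    rw [Formula.boxLe, truth_and, ih, truth_boxPow]
    constructor
    · rintro ⟨h, h'⟩ v ⟨j, hj, hv⟩
      rcases hj.lt_or_eq with hlt | rfl
      · exact h v ⟨j, by omega, hv⟩
      · exact h' v hv
    · exact fun h => ⟨fun v ⟨j, hj, hv⟩ => h v ⟨j, by omega, hv⟩, fun v hv => h v ⟨_, le_rfl, hv⟩⟩

theorem truth_subst {σ : ℕ → Formula k} :
    Truth R θ w (φ.subst σ) ↔ Truth R (fun n => {v | Truth R θ v (σ n)}) w φ := by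
  induction φ generalizing w with
  | var n => rfl
  | bot => rfl
  | imp φ ψ ih1 ih2 => simp only [Formula.subst, Truth, ih1, ih2]
  | dia i φ ih => simp only [Formula.subst, Truth, ih]

/-- Truth is invariant under isomorphisms. -/
theorem truth_equiv {W' : Type*} {R' : Fin k → W' → W' → Prop} (f : W ≃ W')
    (hf : ∀ i x y, R i x y ↔ R' i (f x) (f y)) {θ' : ℕ → Set W'} :
    Truth R (fun n => f ⁻¹' θ' n) w φ ↔ Truth R' θ' (f w) φ := by
  induction φ generalizing w with
  | var n => rfl
  | bot => rfl
  | imp φ ψ ih1 ih2 => simp only [Truth, ih1, ih2]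
  | dia i φ ih =>
    simp only [Truth, ih, hf]
    exact ⟨fun ⟨v, h⟩ => ⟨f v, h⟩, fun ⟨v, h⟩ => ⟨f.symm v, by simpa using h⟩⟩

theorem validOn_equiv {W' : Type*} {R' : Fin k → W' → W' → Prop} (f : W ≃ W')
    (hf : ∀ i x y, R i x y ↔ R' i (f x) (f y)) : ValidOn R φ ↔ ValidOn R' φ := by
  constructor
  · intro h θ' w'
    have := (truth_equiv f hf (w := f.symm w') (φ := φ)).1 (h (fun n => f ⁻¹' θ' n) _)
    simpa using this
  · intro h θ w
    have := (truth_equiv f hf (w := w) (φ := φ) (θ' := fun n => f.symm ⁻¹' θ n)).2 (h _ _)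
    simpa [← Set.preimage_comp] using this

theorem truth_toFirst {R : Fin 2 → W → W → Prop} {φ : Formula 1} :
    Truth R θ w (toFirst φ) ↔ Truth (fun _ => R 0) θ w φ := by
  induction φ generalizing w with
  | var n => rfl
  | bot => rfl
  | imp φ ψ ih1 ih2 => simp only [toFirst, Truth, ih1, ih2]
  | dia i φ ih => simp only [toFirst, Truth, ih]

/-- The least filtration: on the classes of a partition that respects the truth of all formulas
with codes at most `c`, truth of these formulas is preserved. -/
theorem truth_quotRel {s : Setoid W} {c : ℕ}
    (hs : ∀ x y, s x y → ∀ ψ : Formula k, ψ.toCode ≤ c → (Truth R θ x ψ ↔ Truth R θ y ψ))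
    (hφ : φ.toCode ≤ c) :
    Truth (fun i => quotRel s (R i)) (fun n => Quotient.mk s '' θ n) (Quotient.mk s w) φ ↔
      Truth R θ w φ := by
  induction φ generalizing w with
  | var n =>
    constructor
    · rintro ⟨v, hv, hvw⟩
      exact (hs _ _ (Quotient.exact hvw) _ hφ).1 hv
    · exact fun h => ⟨w, h, rfl⟩
  | bot => rfl
  | imp φ ψ ih1 ih2 =>
    have h1 : Nat.pair φ.toCode ψ.toCode ≤ (k + 2) * Nat.pair φ.toCode ψ.toCode :=
      Nat.le_mul_of_pos_left _ (by omega)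
    have h2 := Nat.left_le_pair φ.toCode ψ.toCode
    have h3 := Nat.right_le_pair φ.toCode ψ.toCode
    rw [Formula.toCode] at hφ
    simp only [Truth]
    rw [ih1 (by omega), ih2 (by omega)]
  | dia i φ ih =>
    have h1 : φ.toCode ≤ (k + 2) * φ.toCode := Nat.le_mul_of_pos_left _ (by omega)
    have hφ' := hφ
    rw [Formula.toCode] at hφ'
    simp only [Truth]
    constructor
    · rintro ⟨_, ⟨u, v, huw, rfl, huv⟩, hv⟩
      rw [ih (by omega)] at hv
      -- The edge starts at `u`, where the diamond formula holds; since its own code is at most `c`,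
      -- it passes to the equivalent point `w`.
      exact (hs _ _ (Quotient.exact huw) _ hφ).1 ⟨v, huv, hv⟩
    · rintro ⟨v, hwv, hv⟩
      exact ⟨Quotient.mk s v, ⟨w, v, rfl, rfl, hwv⟩, (ih (by omega)).2 hv⟩

end Truth

/-! ### Correspondence -/

section Correspondence

variable {W : Type*} {R : Fin 1 → W → W → Prop}

/-- Truth at all points under all valuations in the sets of a given family. -/
def ValidFor {k : ℕ} (R : Fin k → W → W → Prop) (P : Set (Set W)) (φ : Formula k) : Prop :=
  ∀ θ : ℕ → Set W, (∀ n, θ n ∈ P) → ∀ w, Truth R θ w φ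

theorem validFor_univ {k : ℕ} {R : Fin k → W → W → Prop} {φ : Formula k} :
    ValidFor R Set.univ φ ↔ ValidOn R φ :=
  ⟨fun h θ => h θ fun _ => trivial, fun h θ _ => h θ⟩

/-- A family of sets, closed under finite intersections, that tells apart `y` from the points in
`j` steps from `x`, unless `y` is one of them. -/
structure IsSeparating (R : W → W → Prop) (P : Set (Set W)) : Prop where
  univ_mem : Set.univ ∈ P
  inter_mem : ∀ A ∈ P, ∀ B ∈ P, A ∩ B ∈ P
  separates : ∀ j x y, ¬ relPow R j x y → ∃ A ∈ P, y ∈ A ∧ ∀ z ∈ A, ¬ relPow R j x z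

theorem isSeparating_univ (R : W → W → Prop) : IsSeparating R Set.univ where
  univ_mem := trivial
  inter_mem := fun _ _ _ _ => trivial
  separates := fun _ _ y h => ⟨{y}, trivial, rfl, by rintro z rfl; exact h⟩

theorem IsSeparating.separates_le {R : W → W → Prop} {P : Set (Set W)} (hP : IsSeparating R P)
    {m : ℕ} {x y : W} (h : ¬ ∃ j ≤ m, relPow R j x y) :
    ∃ A ∈ P, y ∈ A ∧ ∀ z ∈ A, ¬ ∃ j ≤ m, relPow R j x z := by
  induction m with
  | zero =>
    obtain ⟨A, hA, hy, hz⟩ := hP.separates 0 x y fun h' => h ⟨0, le_rfl, h'⟩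
    exact ⟨A, hA, hy, fun z hzA ⟨j, hj, hj'⟩ => hz z hzA (by rwa [Nat.le_zero.1 hj] at hj')⟩
  | succ m ih =>
    obtain ⟨A, hA, hy, hz⟩ := hP.separates (m + 1) x y fun h' => h ⟨_, le_rfl, h'⟩
    obtain ⟨B, hB, hyB, hzB⟩ := ih fun ⟨j, hj, h'⟩ => h ⟨j, by omega, h'⟩
    refine ⟨A ∩ B, hP.inter_mem A hA B hB, ⟨hy, hyB⟩, fun z hzAB ⟨j, hj, hj'⟩ => ?_⟩
    rcases hj.lt_or_eq with hlt | rfl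
    · exact hzB z hzAB.2 ⟨j, by omega, hj'⟩
    · exact hz z hzAB.1 hj'

/-- A point `v` above `w` either sees `w` again, which gives the first disjunct, or is of smaller
depth, which gives the second by induction. -/
theorem truth_heightFormula {m h : ℕ} {θ : ℕ → Set W} (hR : IsMTransitive m (R 0)) (hh : 1 ≤ h)
    {w : W} (hw : ¬ DepthAtLeast (R 0) h w) : Truth R θ w (heightFormula m h) := by
  induction h, hh using Nat.le_induction generalizing w with
  | base =>
    intro hθ
    refine truth_boxLe.2 fun v hv => truth_diaLe.2 ⟨w, (hR v w).1 ?_, hθ⟩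
    by_contra hvw
    exact hw ⟨v, (hR w v).2 hv, hvw, trivial⟩
  | succ h hh ih =>
    obtain ⟨h, rfl⟩ : ∃ g, h = g + 1 := ⟨h - 1, by omega⟩
    intro hθ
    refine truth_boxLe.2 fun v hv => truth_or.2 ?_
    by_cases hvw : Relation.ReflTransGen (R 0) v w
    · exact Or.inl (truth_diaLe.2 ⟨w, (hR v w).1 hvw, hθ⟩)
    · exact Or.inr (ih fun hd => hw ⟨v, (hR w v).2 hv, hvw, hd⟩)

theorem truth_heightFormula_congr {m h : ℕ} (hh : 1 ≤ h) {θ θ' : ℕ → Set W}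
    (hθ : ∀ i ≤ h, θ i = θ' i) {w : W} :
    Truth R θ w (heightFormula m h) ↔ Truth R θ' w (heightFormula m h) := by
  induction h, hh using Nat.le_induction generalizing w with
  | base => simp only [heightFormula, Truth, truth_boxLe, truth_diaLe, hθ 1 le_rfl]
  | succ h hh ih =>
    obtain ⟨h, rfl⟩ : ∃ g, h = g + 1 := ⟨h - 1, by omega⟩
    have ih := fun w => ih (fun i hi => hθ i (by omega)) (w := w)
    simp only [heightFormula, Truth, truth_boxLe, truth_diaLe, truth_or, hθ _ le_rfl, ih]

/-- At each strict ascent from `w` to `v`, the new variable is made true on a set of the family that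
contains `w` and avoids everything reachable from `v`. The refutation already found at `v` uses only
variables of smaller index, so it is not disturbed. -/
theorem exists_not_truth_heightFormula {P : Set (Set W)} (hP : IsSeparating (R 0) P) {m h : ℕ}
    (hR : IsMTransitive m (R 0)) (hh : 1 ≤ h) {w : W} (hw : DepthAtLeast (R 0) h w) :
    ∃ θ : ℕ → Set W, (∀ n, θ n ∈ P) ∧ ¬ Truth R θ w (heightFormula m h) := by
  induction h, hh using Nat.le_induction generalizing w with
  | base =>
    obtain ⟨v, hwv, hvw, -⟩ := hw
    rw [hR] at hvw
    obtain ⟨A, hA, hwA, hz⟩ := hP.separates_le hvw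
    refine ⟨fun _ => A, fun _ => hA, fun ht => ?_⟩
    obtain ⟨z, hz', hzA⟩ := truth_diaLe.1 (truth_boxLe.1 (ht hwA) v ((hR w v).1 hwv))
    exact hz z hzA hz'
  | succ h hh ih =>
    obtain ⟨v, hwv, hvw, hv⟩ := hw
    obtain ⟨θ, hθ, hn⟩ := ih hv
    rw [hR] at hvw
    obtain ⟨A, hA, hwA, hz⟩ := hP.separates_le hvw
    refine ⟨Function.update θ (h + 1) A, fun n => ?_, fun ht => ?_⟩
    · by_cases hn : n = h + 1
      · subst hn; simpa using hA
      · simpa [hn] using hθ n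
    · obtain ⟨g, rfl⟩ : ∃ g, h = g + 1 := ⟨h - 1, by omega⟩
      have hw' : Truth R (Function.update θ (g + 1 + 1) A) w (.var (g + 2)) := by
        simpa [Truth] using hwA
      rcases truth_or.1 (truth_boxLe.1 (ht hw') v ((hR w v).1 hwv)) with h1 | h1
      · obtain ⟨z, hz', hzA⟩ := truth_diaLe.1 h1
        exact hz z (by simpa [Truth] using hzA) hz'
      · rw [truth_heightFormula_congr (θ' := θ) (by omega)] at h1
        · exact hn h1
        · exact fun i hi => Function.update_of_ne (by omega) _ _

theorem heightLe_of_validFor {P : Set (Set W)} (hP : IsSeparating (R 0) P) {m h : ℕ}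
    (hR : IsMTransitive m (R 0)) (hh : 1 ≤ h) (hv : ValidFor R P (heightFormula m h)) :
    HeightLe (R 0) h := by
  rw [heightLe_iff]
  intro w hw
  obtain ⟨θ, hθ, hn⟩ := exists_not_truth_heightFormula hP hR hh hw
  exact hn (hv θ hθ w)

/-- The first axiom comes first: it yields `(n - 1)`-transitivity, under which the bounded
modalities of the height axiom range over all reachable points. -/
theorem classF_of_validFor {P : Set (Set W)} (hP : IsSeparating (R 0) P) {m n h : ℕ}
    (hmn : m < n) (hh : 1 ≤ h) (hv : ∀ ψ ∈ axiomsF m n h, ValidFor R P ψ) :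
    IsMNRelation m n (R 0) ∧ HeightLe (R 0) h := by
  have hR : IsMNRelation m n (R 0) := by
    intro x y hxy
    by_contra hn
    obtain ⟨A, hA, hy, hz⟩ := hP.separates m x y hn
    have := hv _ (Or.inl rfl) (fun _ => A) (fun _ => hA) x (truth_diaPow.2 ⟨y, hxy, hy⟩)
    obtain ⟨z, hz', hzA⟩ := truth_diaPow.1 this
    exact hz z hzA hz'
  exact ⟨hR, heightLe_of_validFor hP (hR.isMTransitive hmn) hh (hv _ (Or.inr rfl))⟩

theorem classG_of_validFor {P : Set (Set W)} (hP : IsSeparating (R 0) P) {m h : ℕ}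
    (hh : 1 ≤ h) (hv : ∀ ψ ∈ axiomsG m h, ValidFor R P ψ) :
    IsMTransitive m (R 0) ∧ HeightLe (R 0) h := by
  have hR : IsMTransitive m (R 0) := by
    refine isMTransitive_of_succ fun x y hxy => ?_
    by_contra hn
    obtain ⟨A, hA, hy, hz⟩ := hP.separates_le hn
    have := hv _ (Or.inl rfl) (fun _ => A) (fun _ => hA) x (truth_diaPow.2 ⟨y, hxy, hy⟩)
    obtain ⟨z, hz', hzA⟩ := truth_diaLe.1 this
    exact hz z hzA hz'
  exact ⟨hR, heightLe_of_validFor hP hR hh (hv _ (Or.inr rfl))⟩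

theorem validOn_axiomsF {m n h : ℕ} (hmn : m < n) (hh : 1 ≤ h) (hR : IsMNRelation m n (R 0))
    (hht : HeightLe (R 0) h) : ∀ ψ ∈ axiomsF m n h, ValidOn R ψ := by
  rintro ψ (rfl | rfl) θ w
  · intro ht
    obtain ⟨v, hv, h⟩ := truth_diaPow.1 ht
    exact truth_diaPow.2 ⟨v, hR w v hv, h⟩
  · exact truth_heightFormula (hR.isMTransitive hmn) hh (heightLe_iff.1 hht w)

theorem validOn_axiomsG {m h : ℕ} (hh : 1 ≤ h) (hR : IsMTransitive m (R 0))
    (hht : HeightLe (R 0) h) : ∀ ψ ∈ axiomsG m h, ValidOn R ψ := by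
  rintro ψ (rfl | rfl) θ w
  · intro ht
    obtain ⟨v, hv, h⟩ := truth_diaPow.1 ht
    exact truth_diaLe.2 ⟨v, (hR w v).1 (reflTransGen_iff_relPow.2 ⟨_, hv⟩), h⟩
  · exact truth_heightFormula hR hh (heightLe_iff.1 hht w)

end Correspondence

/-! ### Maximal sets -/

section Maximal

variable {k : ℕ} {L : Set (Formula k)} {Γ : Set (Formula k)} {φ ψ χ : Formula k} {i : Fin k}

theorem boolVal_neg {v : Formula k → Prop} :
    Formula.boolVal v φ.neg ↔ ¬ Formula.boolVal v φ := Iff.rfl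

theorem boolVal_imp {v : Formula k → Prop} :
    Formula.boolVal v (φ.imp ψ) ↔ (Formula.boolVal v φ → Formula.boolVal v ψ) := Iff.rfl

theorem boolVal_top {v : Formula k → Prop} : Formula.boolVal v .top := id

theorem boolVal_or {v : Formula k → Prop} : Formula.boolVal v (φ.or ψ) ↔
    Formula.boolVal v φ ∨ Formula.boolVal v ψ := by
  simp only [Formula.or, boolVal_imp, boolVal_neg]
  tauto

theorem boolVal_and {v : Formula k → Prop} : Formula.boolVal v (φ.and ψ) ↔
    Formula.boolVal v φ ∧ Formula.boolVal v ψ := by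
  simp only [Formula.and, boolVal_imp, boolVal_neg]
  tauto

theorem boolVal_conj {v : Formula k → Prop} {l : List (Formula k)} :
    Formula.boolVal v (Formula.conj l) ↔ ∀ φ ∈ l, Formula.boolVal v φ := by
  induction l with
  | nil => simpa [Formula.conj] using boolVal_top
  | cons a l ih => simp [Formula.conj, boolVal_and, ih]

namespace IsNormalLogic

variable (hL : IsNormalLogic L)

include hL

theorem of_taut (hφ : φ ∈ L) (h : ∀ v, Formula.boolVal v φ → Formula.boolVal v ψ) : ψ ∈ L :=
  hL.modus_ponens _ _ (hL.taut (φ.imp ψ) h) hφ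

theorem of_taut₂ (hφ : φ ∈ L) (hψ : ψ ∈ L)
    (h : ∀ v, Formula.boolVal v φ → Formula.boolVal v ψ → Formula.boolVal v χ) : χ ∈ L :=
  hL.modus_ponens _ _ (hL.modus_ponens _ _ (hL.taut (φ.imp (ψ.imp χ)) h) hφ) hψ

theorem diaPow_monotone (h : φ.imp ψ ∈ L) (j : ℕ) : (φ.diaPow i j).imp (ψ.diaPow i j) ∈ L := by
  induction j with
  | zero => exact h
  | succ j ih => exact hL.monotone _ _ _ ih

theorem dia_or_mem (φ ψ : Formula k) :
    Formula.imp (.dia i (φ.or ψ)) (.or (.dia i φ) (.dia i ψ)) ∈ L :=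
  hL.subst_mem (fun n => if n = 1 then φ else ψ) _ (hL.dia_or i)

end IsNormalLogic

/-- Lindenbaum's lemma by Zorn: an inconsistency of the union of a chain involves finitely many
formulas, all in one member of the chain. -/
theorem exists_isMaximalSet (hΓ : ¬ IsInconsistent L Γ) : ∃ Δ, Γ ⊆ Δ ∧ IsMaximalSet L Δ := by
  obtain ⟨Δ, hΓΔ, hΔ⟩ := zorn_subset_nonempty {Δ | ¬ IsInconsistent L Δ} (fun c hc hchain hne => by
    refine ⟨⋃₀ c, ?_, fun s hs => Set.subset_sUnion_of_mem hs⟩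
    rintro ⟨l, hl, hn⟩
    have : ∃ s ∈ c, ∀ φ ∈ l, φ ∈ s := by
      clear hn
      induction l with
      | nil => exact hne.elim fun s hs => ⟨s, hs, by simp⟩
      | cons a l ih =>
        obtain ⟨s, hs, hls⟩ := ih fun φ hφ => hl φ (List.mem_cons_of_mem _ hφ)
        obtain ⟨t, ht, hat⟩ := hl a List.mem_cons_self
        rcases hchain.total hs ht with hst | hts
        · exact ⟨t, ht, by simpa using ⟨hat, fun φ hφ => hst (hls φ hφ)⟩⟩
        · exact ⟨s, hs, by simpa using ⟨hts hat, hls⟩⟩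
    obtain ⟨s, hs, hls⟩ := this
    exact hc hs ⟨l, hls, hn⟩) Γ hΓ
  refine ⟨Δ, hΓΔ, hΔ.prop, fun Θ hΘ => ?_⟩
  by_contra hcon
  exact hΘ.2 (hΔ.le_of_ge hcon hΘ.1)

namespace IsMaximalSet

theorem exists_list_of_notMem (hΓ : IsMaximalSet L Γ) (hφ : φ ∉ Γ) :
    ∃ l : List (Formula k), (∀ ψ ∈ l, ψ ∈ insert φ Γ) ∧ (Formula.conj l).neg ∈ L :=
  hΓ.2 _ (Set.ssubset_insert hφ)

theorem mem_of_conj_imp (hΓ : IsMaximalSet L Γ) (hL : IsNormalLogic L) {l : List (Formula k)}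
    (hl : ∀ φ ∈ l, φ ∈ Γ) (h : (Formula.conj l).imp ψ ∈ L) : ψ ∈ Γ := by
  classical
  by_contra hψ
  obtain ⟨l', hl', hn⟩ := hΓ.exists_list_of_notMem hψ
  -- As `l` already implies `ψ`, the occurrences of `ψ` in `l'` can be dropped, leaving an
  -- inconsistent list inside `Γ`.
  refine hΓ.1 ⟨l ++ l'.filter (· ≠ ψ), fun φ hφ => ?_, hL.of_taut₂ h hn fun v h1 h2 h3 => h2 ?_⟩
  · rcases List.mem_append.1 hφ with hφ | hφ
    · exact hl φ hφ
    · obtain ⟨h1, h2⟩ := List.mem_filter.1 hφ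
      exact (hl' φ h1).resolve_left (by simpa using h2)
  · rw [boolVal_conj] at h3 ⊢
    intro φ hφ
    by_cases hφψ : φ = ψ
    · subst hφψ
      exact h1 (boolVal_conj.2 fun χ hχ => h3 χ (List.mem_append_left _ hχ))
    · exact h3 φ (List.mem_append_right _ (List.mem_filter.2 ⟨hφ, by simpa using hφψ⟩))

theorem mem_of_imp (hΓ : IsMaximalSet L Γ) (hL : IsNormalLogic L) (h : φ.imp ψ ∈ L) (hφ : φ ∈ Γ) :
    ψ ∈ Γ :=
  hΓ.mem_of_conj_imp hL (l := [φ]) (by simpa using hφ)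
    (hL.of_taut h fun v h1 h2 => h1 (boolVal_conj.1 h2 φ (by simp)))

theorem mem_of_mem (hΓ : IsMaximalSet L Γ) (hL : IsNormalLogic L) (h : φ ∈ L) : φ ∈ Γ :=
  hΓ.mem_of_conj_imp hL (l := []) (by simp) (hL.of_taut h fun _ h1 _ => h1)

theorem bot_notMem (hΓ : IsMaximalSet L Γ) (hL : IsNormalLogic L) : .bot ∉ Γ := fun h =>
  hΓ.1 ⟨[.bot], by simpa using h, hL.taut _ fun _ h1 => boolVal_conj.1 h1 .bot (by simp)⟩

theorem neg_mem_of_notMem (hΓ : IsMaximalSet L Γ) (hL : IsNormalLogic L) (h : φ ∉ Γ) :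
    φ.neg ∈ Γ := by
  classical
  obtain ⟨l, hl, hn⟩ := hΓ.exists_list_of_notMem h
  refine hΓ.mem_of_conj_imp hL (l := l.filter (· ≠ φ)) (fun ψ hψ => ?_)
    (hL.of_taut hn fun v h1 h2 h3 => h1 (boolVal_conj.2 fun ψ hψ => ?_))
  · obtain ⟨h1, h2⟩ := List.mem_filter.1 hψ
    exact (hl ψ h1).resolve_left (by simpa using h2)
  · by_cases hφψ : ψ = φ
    · exact hφψ ▸ h3
    · exact boolVal_conj.1 h2 ψ (List.mem_filter.2 ⟨hψ, by simpa using hφψ⟩)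

theorem imp_mem_iff (hΓ : IsMaximalSet L Γ) (hL : IsNormalLogic L) :
    φ.imp ψ ∈ Γ ↔ (φ ∈ Γ → ψ ∈ Γ) := by
  constructor
  · intro h hφ
    refine hΓ.mem_of_conj_imp hL (l := [φ.imp ψ, φ]) (by simpa using ⟨h, hφ⟩)
      (hL.taut _ fun v h1 => ?_)
    rw [boolVal_conj] at h1
    exact h1 (φ.imp ψ) (by simp) (h1 φ (by simp))
  · intro h
    by_cases hφ : φ ∈ Γ
    · exact hΓ.mem_of_imp hL (hL.taut _ fun _ h1 _ => h1) (h hφ)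
    · exact hΓ.mem_of_imp hL (hL.taut (φ.neg.imp (φ.imp ψ)) fun _ h1 h2 => (h1 h2).elim)
        (hΓ.neg_mem_of_notMem hL hφ)

theorem neg_mem_iff (hΓ : IsMaximalSet L Γ) (hL : IsNormalLogic L) : φ.neg ∈ Γ ↔ φ ∉ Γ := by
  rw [Formula.neg, hΓ.imp_mem_iff hL]
  exact ⟨fun h h' => hΓ.bot_notMem hL (h h'), fun h h' => (h h').elim⟩

theorem or_mem_iff (hΓ : IsMaximalSet L Γ) (hL : IsNormalLogic L) :
    φ.or ψ ∈ Γ ↔ φ ∈ Γ ∨ ψ ∈ Γ := by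
  rw [Formula.or, hΓ.imp_mem_iff hL, hΓ.neg_mem_iff hL]
  tauto

theorem and_mem_iff (hΓ : IsMaximalSet L Γ) (hL : IsNormalLogic L) :
    φ.and ψ ∈ Γ ↔ φ ∈ Γ ∧ ψ ∈ Γ := by
  rw [Formula.and, hΓ.neg_mem_iff hL, hΓ.imp_mem_iff hL, hΓ.neg_mem_iff hL]
  tauto

theorem eq_of_subset {Δ : Set (Formula k)} (hΓ : IsMaximalSet L Γ) (hΔ : IsMaximalSet L Δ)
    (h : Γ ⊆ Δ) : Γ = Δ := by
  by_contra hne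
  exact hΔ.1 (hΓ.2 Δ (h.ssubset_of_ne hne))

end IsMaximalSet

/-! ### The canonical model -/

/-- The existence lemma. -/
theorem exists_canonicalRel (hL : IsNormalLogic L) (x : CanonicalWorld L) {Y : Set (Formula k)}
    (htop : .top ∈ Y) (hand : ∀ φ ∈ Y, ∀ ψ ∈ Y, φ.and ψ ∈ Y) (hY : ∀ φ ∈ Y, .dia i φ ∈ x.1) :
    ∃ y : CanonicalWorld L, canonicalRel L i x y ∧ Y ⊆ y.1 := by
  have hcon : ¬ IsInconsistent L (Y ∪ {φ | ∃ ψ, .dia i ψ ∉ x.1 ∧ ψ.neg = φ}) := by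
    rintro ⟨l, hl, hn⟩
    -- The formula `φ` stays general in the induction so that members of `Y` can be absorbed into
    -- it. For a member `¬ψ`, the diamond distributes over the case split on `ψ`, and `◇ψ` is not in
    -- `x`.
    have key : ∀ φ ∈ Y, .dia i (φ.and (Formula.conj l)) ∈ x.1 := by
      clear hn
      induction l with
      | nil =>
        intro φ hφ
        exact x.2.mem_of_imp hL (hL.monotone i _ _ (hL.taut _ fun v h1 =>
          boolVal_and.2 ⟨h1, boolVal_top⟩)) (hY φ hφ)
      | cons a l ih =>
        intro φ hφ
        have ih := ih fun φ hφ => hl φ (List.mem_cons_of_mem _ hφ)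
        rcases hl a List.mem_cons_self with ha | ⟨ψ, hψ, rfl⟩
        · refine x.2.mem_of_imp hL (hL.monotone i _ _ (hL.taut _ fun v => ?_))
            (ih _ (hand φ hφ a ha))
          simp only [Formula.conj, boolVal_and, boolVal_imp]
          tauto
        · have h1 : .dia i (((φ.and (Formula.conj (ψ.neg :: l))).or ψ)) ∈ x.1 := by
            refine x.2.mem_of_imp hL (hL.monotone i _ _ (hL.taut _ fun v => ?_)) (ih φ hφ)
            simp only [Formula.conj, boolVal_and, boolVal_imp, boolVal_or, boolVal_neg]
            tauto
          exact ((x.2.or_mem_iff hL).1 (x.2.mem_of_imp hL (hL.dia_or_mem _ _) h1)).resolve_right hψ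
    refine x.2.bot_notMem hL (x.2.mem_of_imp hL (hL.dia_bot i)
      (x.2.mem_of_imp hL (hL.monotone i _ _ (hL.of_taut hn fun v h1 h2 => ?_)) (key _ htop)))
    exact h1 (boolVal_and.1 h2).2
  obtain ⟨y, hsub, hy⟩ := exists_isMaximalSet hcon
  refine ⟨⟨y, hy⟩, fun φ hφ => ?_, fun φ hφ => hsub (Or.inl hφ)⟩
  by_contra hn
  exact (hy.neg_mem_iff hL).1 (hsub (Or.inr ⟨φ, hn, rfl⟩)) hφ

theorem dia_mem_iff (hL : IsNormalLogic L) (x : CanonicalWorld L) :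
    .dia i φ ∈ x.1 ↔ ∃ y : CanonicalWorld L, canonicalRel L i x y ∧ φ ∈ y.1 := by
  refine ⟨fun h => ?_, fun ⟨y, hxy, hy⟩ => hxy φ hy⟩
  obtain ⟨y, hxy, hy⟩ := exists_canonicalRel (i := i) hL x (Y := {ψ | φ.imp ψ ∈ L})
    (hL.taut _ fun _ _ => boolVal_top)
    (fun ψ hψ χ hχ => hL.of_taut₂ hψ hχ fun v h1 h2 h3 => boolVal_and.2 ⟨h1 h3, h2 h3⟩)
    (fun ψ hψ => x.2.mem_of_imp hL (hL.monotone i _ _ hψ) h)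
  exact ⟨y, hxy, hy (hL.taut _ fun _ h => h)⟩

theorem relPow_canonicalRel_iff (hL : IsNormalLogic L) {j : ℕ} {x y : CanonicalWorld L} :
    relPow (canonicalRel L i) j x y ↔ ∀ φ ∈ y.1, φ.diaPow i j ∈ x.1 := by
  induction j generalizing x with
  | zero =>
    exact ⟨fun h φ hφ => by cases h; exact hφ, fun h => Subtype.ext (y.2.eq_of_subset x.2 h).symm⟩
  | succ j ih =>
    rw [relPow_succ_left]
    constructor
    · rintro ⟨z, hxz, hzy⟩ φ hφ
      exact hxz _ (ih.1 hzy φ hφ)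
    · intro h
      obtain ⟨z, hxz, hz⟩ := exists_canonicalRel (i := i) hL x
        -- The intermediate point must contain `◇^j φ` for all `φ ∈ y`. Taking all consequences of
        -- these makes the set closed under conjunction, since `◇^j (φ ∧ φ')` implies both `◇^j φ`
        -- and `◇^j φ'`.
        (Y := {ψ | ∃ φ ∈ y.1, (φ.diaPow i j).imp ψ ∈ L})
        ⟨.top, y.2.mem_of_mem hL (hL.taut _ fun _ => boolVal_top), hL.taut _ fun _ _ => boolVal_top⟩
        (by
          rintro ψ ⟨φ, hφ, hψ⟩ ψ' ⟨φ', hφ', hψ'⟩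
          refine ⟨φ.and φ', (y.2.and_mem_iff hL).2 ⟨hφ, hφ'⟩, ?_⟩
          have h1 := hL.diaPow_monotone (i := i)
            (hL.taut ((φ.and φ').imp φ) fun v h => (boolVal_and.1 h).1) j
          have h2 := hL.diaPow_monotone (i := i)
            (hL.taut ((φ.and φ').imp φ') fun v h => (boolVal_and.1 h).2) j
          have h1 := hL.of_taut₂ (χ := ((φ.and φ').diaPow i j).imp ψ) h1 hψ
            fun v g g' g'' => g' (g g'')
          have h2 := hL.of_taut₂ (χ := ((φ.and φ').diaPow i j).imp ψ') h2 hψ'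
            fun v g g' g'' => g' (g g'')
          exact hL.of_taut₂ h1 h2 fun v g g' g'' => boolVal_and.2 ⟨g g'', g' g''⟩)
        (by
          rintro ψ ⟨φ, hφ, hψ⟩
          exact x.2.mem_of_imp hL (hL.monotone i _ _ hψ) (h φ hφ))
      exact ⟨z, hxz, ih.2 fun φ hφ => hz ⟨φ, hφ, hL.taut _ fun _ h => h⟩⟩

/-- The truth lemma. -/
theorem truth_canonical (hL : IsNormalLogic L) (σ : ℕ → Formula k) (x : CanonicalWorld L) :
    Truth (canonicalRel L) (fun n => {y : CanonicalWorld L | σ n ∈ y.1}) x φ ↔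
      φ.subst σ ∈ x.1 := by
  induction φ generalizing x with
  | var n => rfl
  | bot => exact ⟨False.elim, x.2.bot_notMem hL⟩
  | imp φ ψ ih1 ih2 => rw [Truth, Formula.subst, ih1, ih2, x.2.imp_mem_iff hL]
  | dia i φ ih => simp only [Truth, Formula.subst, ih, dia_mem_iff hL]

theorem subst_var (φ : Formula k) : φ.subst .var = φ := by
  induction φ with
  | var n => rfl
  | bot => rfl
  | imp φ ψ ih1 ih2 => rw [Formula.subst, ih1, ih2]
  | dia i φ ih => rw [Formula.subst, ih]

/-- The sets of points of the canonical frame that are defined by formulas. -/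
def definableSets (L : Set (Formula k)) : Set (Set (CanonicalWorld L)) :=
  {A | ∃ φ, {x : CanonicalWorld L | φ ∈ x.1} = A}

theorem isSeparating_definableSets (hL : IsNormalLogic L) (i : Fin k) :
    IsSeparating (canonicalRel L i) (definableSets L) where
  univ_mem := ⟨.top, Set.eq_univ_of_forall fun x =>
    x.2.mem_of_mem hL (hL.taut _ fun _ => boolVal_top)⟩
  inter_mem := by
    rintro _ ⟨φ, rfl⟩ _ ⟨ψ, rfl⟩
    exact ⟨φ.and ψ, Set.ext fun x => x.2.and_mem_iff hL⟩
  separates := by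
    intro j x y h
    rw [relPow_canonicalRel_iff hL] at h
    push Not at h
    obtain ⟨φ, hφ, hn⟩ := h
    exact ⟨_, ⟨φ, rfl⟩, hφ, fun z hz hxz => hn ((relPow_canonicalRel_iff hL).1 hxz φ hz)⟩

/-- A definable valuation amounts to a substitution, and `L` is closed under substitution. -/
theorem validFor_definableSets (hL : IsNormalLogic L) (hφ : φ ∈ L) :
    ValidFor (canonicalRel L) (definableSets L) φ := by
  intro θ hθ x
  choose σ hσ using hθ
  obtain rfl : (fun n => {y : CanonicalWorld L | σ n ∈ y.1}) = θ := funext hσ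
  exact (truth_canonical hL σ x).2 (x.2.mem_of_mem hL (hL.subst_mem σ φ hφ))

/-- Completeness for the canonical frame. Validity is only demanded when that frame has points,
because frames of a class are nonempty; a formula outside `L` supplies a point. -/
theorem mem_of_validOn_canonicalRel (hL : IsNormalLogic L)
    (h : Nonempty (CanonicalWorld L) → ValidOn (canonicalRel L) φ) : φ ∈ L := by
  by_contra hφ
  have hcon : ¬ IsInconsistent L {φ.neg} := by
    rintro ⟨l, hl, hn⟩
    refine hφ (hL.of_taut hn fun v h1 => ?_)
    by_contra h2
    exact h1 (boolVal_conj.2 fun ψ hψ => by rw [hl ψ hψ]; exact h2)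
  obtain ⟨x, hsub, hx⟩ := exists_isMaximalSet hcon
  have ht := (truth_canonical hL .var ⟨x, hx⟩).1 (h ⟨⟨x, hx⟩⟩ _ _)
  rw [subst_var] at ht
  exact (hx.neg_mem_iff hL).1 (hsub rfl) ht

end Maximal

/-! ### Logics -/

section Logics

variable {k : ℕ}

theorem isNormalLogic_leastLogic (Φ : Set (Formula k)) : IsNormalLogic (leastLogic Φ) where
  taut φ hφ _ hL _ := hL.taut φ hφ
  dia_bot i _ hL _ := hL.dia_bot i
  dia_or i _ hL _ := hL.dia_or i
  modus_ponens φ ψ h h' L hL hΦ := hL.modus_ponens φ ψ (h L hL hΦ) (h' L hL hΦ)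
  subst_mem σ φ h L hL hΦ := hL.subst_mem σ φ (h L hL hΦ)
  monotone i φ ψ h L hL hΦ := hL.monotone i φ ψ (h L hL hΦ)

theorem subset_leastLogic (Φ : Set (Formula k)) : Φ ⊆ leastLogic Φ :=
  fun _ hφ _ _ hΦ => hΦ hφ

theorem leastLogic_subset {Φ L : Set (Formula k)} (hL : IsNormalLogic L) (h : Φ ⊆ L) :
    leastLogic Φ ⊆ L :=
  fun _ hφ => hφ L hL h

theorem boolVal_truth {W : Type*} {R : Fin k → W → W → Prop} {θ : ℕ → Set W} {w : W}
    {φ : Formula k} : Formula.boolVal (Truth R θ w) φ ↔ Truth R θ w φ := by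
  induction φ with
  | var n => rfl
  | bot => rfl
  | imp φ ψ ih1 ih2 => rw [boolVal_imp, ih1, ih2]; rfl
  | dia i φ => rfl

theorem isNormalLogic_log (C : Set (Frame.{u} k)) : IsNormalLogic (Log C) where
  taut φ hφ F _ θ w := boolVal_truth.1 (hφ _)
  dia_bot i F _ θ w := fun ⟨_, _, h⟩ => h
  dia_or i F _ θ w := by
    rintro ⟨v, hv, h⟩
    exact truth_or.2 ((truth_or.1 h).imp (fun h => ⟨v, hv, h⟩) fun h => ⟨v, hv, h⟩)
  modus_ponens φ ψ h h' F hF θ w := h F hF θ w (h' F hF θ w)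
  subst_mem σ φ h F hF θ w := truth_subst.2 (h F hF _ w)
  monotone i φ ψ h F hF θ w := fun ⟨v, hv, hφ⟩ => ⟨v, hv, h F hF θ v hφ⟩

/-- The copy of a frame in a higher universe. -/
def liftFrame {W : Type} (hW : Nonempty W) (R : Fin k → W → W → Prop) : Frame.{u} k where
  W := ULift.{u} W
  nonempty := hW.map ULift.up
  R i x y := R i x.down y.down

theorem validOn_liftFrame {W : Type} (hW : Nonempty W) (R : Fin k → W → W → Prop)
    {φ : Formula k} : ValidOn (liftFrame.{u} hW R).R φ ↔ ValidOn R φ :=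
  validOn_equiv Equiv.ulift fun _ _ _ => Iff.rfl

theorem liftFrame_tense {W : Type} (hW : Nonempty W) (R : Fin 2 → W → W → Prop)
    (hR : ∀ x y, R 1 x y ↔ R 0 y x) :
    (liftFrame.{u} hW fun _ => R 0).tense = liftFrame.{u} hW R := by
  have : (liftFrame.{u} hW fun _ : Fin 1 => R 0).tense.R = (liftFrame.{u} hW R).R := by
    funext i x y
    fin_cases i
    · rfl
    · exact propext (hR x.down y.down).symm
  exact congrArg (Frame.mk (ULift.{u} W) (hW.map ULift.up)) this

theorem validOn_tense_toFirst {F : Frame.{u} 1} {φ : Formula 1} :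
    ValidOn F.tense.R (toFirst φ) ↔ ValidOn F.R φ := by
  have : (fun _ : Fin 1 => F.tense.R 0) = F.R := by
    funext i
    rw [Subsingleton.elim i 0]
    rfl
  simp only [ValidOn, truth_toFirst]
  rw [this]
  rfl

theorem converseAxioms_subset (C : Set (Frame.{u} 1)) : converseAxioms ⊆ Log (tenseClass C) := by
  rintro φ (rfl | rfl) _ ⟨F, hF, rfl⟩ θ w h ⟨v, hwv, hv⟩
  · exact hv ⟨w, hwv, h⟩
  · exact hv ⟨w, hwv, h⟩

theorem tenseExtension_subset (C : Set (Frame.{u} 1)) :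
    tenseExtension (Log C) ⊆ Log (tenseClass C) := by
  refine leastLogic_subset (isNormalLogic_log _) (Set.union_subset ?_ (converseAxioms_subset C))
  rintro _ ⟨φ, hφ, rfl⟩ _ ⟨F, hF, rfl⟩
  exact validOn_tense_toFirst.2 (hφ F hF)

theorem canonicalRel_converse {L : Set (Formula 2)} (hL : IsNormalLogic L)
    (h : converseAxioms ⊆ L) (x y : CanonicalWorld L) :
    canonicalRel L 1 x y ↔ canonicalRel L 0 y x := by
  have aux : ∀ i j : Fin 2,
      .imp (.var 0) (.neg (.dia i (.neg (.dia j (.var 0))))) ∈ L →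
      ∀ x y : CanonicalWorld L, canonicalRel L i x y → canonicalRel L j y x := by
    intro i j hij x y hxy φ hφ
    by_contra hn
    -- If `◇ⱼφ` were missing from `y`, then `¬◇ⱼφ ∈ y` would put `◇ᵢ¬◇ⱼφ` into `x`, against the
    -- converse axiom.
    have h1 := x.2.mem_of_imp hL (hL.subst_mem (fun _ => φ) _ hij) hφ
    exact (x.2.neg_mem_iff hL).1 h1 (hxy _ ((y.2.neg_mem_iff hL).2 hn))
  exact ⟨aux 1 0 (h (Or.inr rfl)) x y, aux 0 1 (h (Or.inl rfl)) y x⟩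

variable {C : Set (Frame.{u} 1)} {Ax : Set (Formula 1)}

/-- A class of frames is defined by a set of formulas whose validity follows from the truth under
all valuations in a separating family. -/
structure IsCanonicallyDefinedBy (C : Set (Frame.{u} 1)) (Ax : Set (Formula 1)) : Prop where
  mem_iff : ∀ F : Frame.{u} 1, F ∈ C ↔ ∀ ψ ∈ Ax, ValidOn F.R ψ
  validOn : ∀ {W : Type} {R : Fin 1 → W → W → Prop} {P : Set (Set W)}, IsSeparating (R 0) P →
    (∀ ψ ∈ Ax, ValidFor R P ψ) → ∀ ψ ∈ Ax, ValidOn R ψ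

namespace IsCanonicallyDefinedBy

variable (hC : IsCanonicallyDefinedBy C Ax)

include hC

theorem subset_log : Ax ⊆ Log C := fun ψ hψ F hF => (hC.mem_iff F).1 hF ψ hψ

theorem liftFrame_mem {W : Type} (hW : Nonempty W) {R : Fin 1 → W → W → Prop} :
    liftFrame.{u} hW R ∈ C ↔ ∀ ψ ∈ Ax, ValidOn R ψ := by
  simp only [hC.mem_iff, validOn_liftFrame]

theorem canonicalFrame_mem {L : Set (Formula 1)} (hL : IsNormalLogic L) (hAx : Ax ⊆ L)
    (hW : Nonempty (CanonicalWorld L)) : liftFrame.{u} hW (canonicalRel L) ∈ C :=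
  (hC.liftFrame_mem hW).2 (hC.validOn (isSeparating_definableSets hL 0)
    fun _ hψ => validFor_definableSets hL (hAx hψ))

theorem log_eq : Log C = leastLogic Ax := by
  have hL := isNormalLogic_leastLogic Ax
  refine Set.Subset.antisymm (fun φ hφ => mem_of_validOn_canonicalRel hL fun hW => ?_)
    (leastLogic_subset (isNormalLogic_log C) hC.subset_log)
  exact (validOn_liftFrame hW _).1 (hφ _ (hC.canonicalFrame_mem hL (subset_leastLogic Ax) hW))

theorem isCanonical_log (hne : C.Nonempty) : IsCanonical (Log C) := by
  refine ⟨isNormalLogic_log C, fun hbot => ?_, fun φ hφ θ w => ?_⟩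
  · obtain ⟨F, hF⟩ := hne
    exact F.nonempty.elim fun w => hbot F hF (fun _ => ∅) w
  · exact (validOn_liftFrame ⟨w⟩ _).1
      (hφ _ (hC.canonicalFrame_mem (isNormalLogic_log C) hC.subset_log ⟨w⟩)) θ w

theorem log_tenseClass : Log (tenseClass C) = tenseExtension (Log C) := by
  have hL : IsNormalLogic (tenseExtension (Log C)) := isNormalLogic_leastLogic _
  have hsub : toFirst '' Log C ∪ converseAxioms ⊆ tenseExtension (Log C) := subset_leastLogic _
  refine Set.Subset.antisymm (fun φ hφ => mem_of_validOn_canonicalRel hL fun hW => ?_)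
    (tenseExtension_subset C)
  have hmem : liftFrame.{u} hW (fun _ : Fin 1 => canonicalRel (tenseExtension (Log C)) 0) ∈ C := by
    -- Only the first relation is tested against the unimodal axioms, but the separating sets are
    -- those definable by bimodal formulas.
    refine (hC.liftFrame_mem hW).2 (hC.validOn (isSeparating_definableSets hL 0) ?_)
    intro ψ hψ θ hθ w
    exact truth_toFirst.1 (validFor_definableSets hL
      (hsub (Or.inl ⟨ψ, hC.subset_log hψ, rfl⟩)) θ hθ w)
  have hφ' := hφ _ ⟨_, hmem, rfl⟩
  rw [liftFrame_tense hW _ (canonicalRel_converse hL (Set.subset_union_right.trans hsub))] at hφ'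
  exact (validOn_liftFrame hW _).1 hφ'

end IsCanonicallyDefinedBy

end Logics

/-! ### Finite models coded by numbers -/

section Coding

theorem primrec_pow : Primrec₂ ((· ^ ·) : ℕ → ℕ → ℕ) := Primrec₂.unpaired'.1 Nat.Primrec.pow

theorem primrecPred_testBit {α : Type*} [Primcodable α] {f g : α → ℕ} (hf : Primrec f)
    (hg : Primrec g) : PrimrecPred fun a => (f a).testBit (g a) = true := by
  refine PrimrecPred.of_eq (p := fun a => f a / 2 ^ g a % 2 = 1) ?_ fun a => by
    rw [Nat.testBit_eq_decide_div_mod_eq, decide_eq_true_iff]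
  exact Primrec.eq.comp (Primrec.nat_mod.comp (Primrec.nat_div.comp hf
    (primrec_pow.comp (Primrec.const 2) hg)) (Primrec.const 2)) (Primrec.const 1)

theorem exists_testBit_iff (p : ℕ → Prop) (K : ℕ) :
    ∃ r < 2 ^ K, ∀ i < K, (r.testBit i = true ↔ p i) := by
  classical
  refine ⟨Nat.ofBits fun i : Fin K => decide (p i), Nat.ofBits_lt_two_pow _, fun i hi => ?_⟩
  rw [Nat.testBit_ofBits_lt _ _ hi, decide_eq_true_iff]

/-- The relation on `Fin N` coded by the binary digits of `r`, and its converse. -/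
def codedRel (N r : ℕ) : Fin 2 → Fin N → Fin N → Prop :=
  ![fun x y => r.testBit (x.1 * N + y.1) = true, fun x y => r.testBit (y.1 * N + x.1) = true]

/-- The valuation on `Fin N` coded by the binary digits of `v`. -/
def codedVal (N v : ℕ) : ℕ → Set (Fin N) := fun p => {x | v.testBit (p * N + x.1) = true}

/-- Truth of the formula with the code `c` at the point `x` of a coded model. -/
def codedTruth (a : ℕ × ℕ × ℕ) (c x : ℕ) : Prop :=
  ∃ h : x < a.1, Truth (codedRel a.1 a.2.1) (codedVal a.1 a.2.2) ⟨x, h⟩ (Formula.ofCode c)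

open Classical in
/-- The truth values of a formula at the points of a coded model. -/
noncomputable def truthTable (a : ℕ × ℕ × ℕ) (c : ℕ) : List Bool :=
  (List.range a.1).map fun x => decide (codedTruth a c x)

/-- The default `false` matches the requirement `x < a.1` in `codedTruth`. -/
theorem getD_truthTable {a : ℕ × ℕ × ℕ} {c x : ℕ} :
    (truthTable a c).getD x false = true ↔ codedTruth a c x := by
  by_cases hx : x < a.1
  · simp [truthTable, List.getD, hx]
  · simp only [truthTable, List.getD, List.getElem?_map]
    rw [List.getElem?_eq_none (by simpa using hx)]
    exact ⟨fun h => by simp at h, fun h => (hx h.1).elim⟩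

/-- The entry at `y` of the row `c` of a table of truth values. -/
def entry (l : List (List Bool)) (c y : ℕ) : Prop := (l.getD c []).getD y false = true

theorem primrecPred_entry {α : Type*} [Primcodable α] {f : α → List (List Bool)} {g h : α → ℕ}
    (hf : Primrec f) (hg : Primrec g) (hh : Primrec h) :
    PrimrecPred fun a => entry (f a) (g a) (h a) :=
  Primrec.eq.comp ((Primrec.list_getD false).comp ((Primrec.list_getD []).comp hf hg) hh)
    (Primrec.const true)

theorem primrecPred_forall_lt {α : Type*} [Primcodable α] {p : ℕ → α → Prop} {n : α → ℕ}
    (hn : Primrec n) (hp : PrimrecPred fun b : ℕ × α => p b.1 b.2) :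
    PrimrecPred fun a => ∀ x < n a, p x a :=
  ((PrimrecRel.forall_mem_list (R := p) hp).comp (Primrec.list_range.comp hn) Primrec.id).of_eq
    fun a => by simp only [List.mem_range, id]

theorem primrecPred_exists_lt {α : Type*} [Primcodable α] {p : ℕ → α → Prop} {n : α → ℕ}
    (hn : Primrec n) (hp : PrimrecPred fun b : ℕ × α => p b.1 b.2) :
    PrimrecPred fun a => ∃ x < n a, p x a :=
  ((PrimrecRel.exists_mem_list (R := p) hp).comp (Primrec.list_range.comp hn) Primrec.id).of_eq
    fun a => by simp only [List.mem_range, id]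

/-- The truth condition at `x` for the formula with the code `l.length` in terms of the truth
values `l` of the formulas with smaller codes, where `q = (l.length - 1) / 4`. -/
def truthStep (N r v : ℕ) (l : List (List Bool)) (q x : ℕ) : Prop :=
  l.length ≠ 0 ∧
    (((l.length - 1) % 4 = 0 ∧ v.testBit (q * N + x) = true) ∨
      ((l.length - 1) % 4 = 1 ∧ (¬ entry l q.unpair.1 x ∨ entry l q.unpair.2 x)) ∨
      ((l.length - 1) % 4 = 2 ∧ ∃ y < N, r.testBit (x * N + y) = true ∧ entry l q y) ∨
      ((l.length - 1) % 4 = 3 ∧ ∃ y < N, r.testBit (y * N + x) = true ∧ entry l q y))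

theorem primrecPred_truthStep {α : Type*} [Primcodable α] {N r v q x : α → ℕ}
    {l : α → List (List Bool)} (hN : Primrec N) (hr : Primrec r) (hv : Primrec v) (hl : Primrec l)
    (hq : Primrec q) (hx : Primrec x) :
    PrimrecPred fun a => truthStep (N a) (r a) (v a) (l a) (q a) (x a) := by
  have hlen : Primrec fun a => (l a).length := Primrec.list_length.comp hl
  have hmod : ∀ j : ℕ, PrimrecPred fun a => ((l a).length - 1) % 4 = j := fun j =>
    Primrec.eq.comp (Primrec.nat_mod.comp (Primrec.nat_sub.comp hlen (Primrec.const 1))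
      (Primrec.const 4)) (Primrec.const j)
  have hu : Primrec fun a => (q a).unpair := Primrec.unpair.comp hq
  have hl2 : Primrec fun b : ℕ × α => l b.2 := hl.comp Primrec.snd
  have hq2 : Primrec fun b : ℕ × α => q b.2 := hq.comp Primrec.snd
  have hr2 : Primrec fun b : ℕ × α => r b.2 := hr.comp Primrec.snd
  have hN2 : Primrec fun b : ℕ × α => N b.2 := hN.comp Primrec.snd
  have hx2 : Primrec fun b : ℕ × α => x b.2 := hx.comp Primrec.snd
  have hy : Primrec fun b : ℕ × α => b.1 := Primrec.fst
  have hentry : PrimrecPred fun b : ℕ × α => entry (l b.2) (q b.2) b.1 :=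
    primrecPred_entry hl2 hq2 hy
  refine PrimrecPred.and (PrimrecPred.not (Primrec.eq.comp hlen (Primrec.const 0))) ?_
  refine PrimrecPred.or ((hmod 0).and ?_) (PrimrecPred.or ((hmod 1).and ?_)
    (PrimrecPred.or ((hmod 2).and ?_) ((hmod 3).and ?_)))
  · exact primrecPred_testBit hv (Primrec.nat_add.comp (Primrec.nat_mul.comp hq hN) hx)
  · exact (primrecPred_entry hl (Primrec.fst.comp hu) hx).not.or
      (primrecPred_entry hl (Primrec.snd.comp hu) hx)
  · exact primrecPred_exists_lt hN ((primrecPred_testBit hr2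
      (Primrec.nat_add.comp (Primrec.nat_mul.comp hx2 hN2) hy)).and hentry)
  · exact primrecPred_exists_lt hN ((primrecPred_testBit hr2
      (Primrec.nat_add.comp (Primrec.nat_mul.comp hy hN2) hx2)).and hentry)

theorem truthStep_iff {a : ℕ × ℕ × ℕ} {c x : ℕ} (hx : x < a.1) :
    truthStep a.1 a.2.1 a.2.2 ((List.range c).map (truthTable a)) ((c - 1) / 4) x ↔
      codedTruth a c x := by
  have hentry : ∀ d y, d < c →
      (entry ((List.range c).map (truthTable a)) d y ↔ codedTruth a d y) := by
    intro d y hd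
    rw [← getD_truthTable, entry]
    simp [List.getD, hd]
  cases c with
  | zero => simp [truthStep, codedTruth, Formula.ofCode, Truth]
  | succ k =>
    have hq : k / 4 < k + 1 := Nat.lt_succ_of_le (Nat.div_le_self _ _)
    have h1 := hentry _ x (lt_of_le_of_lt (Nat.unpair_left_le (k / 4)) hq)
    have h2 := hentry _ x (lt_of_le_of_lt (Nat.unpair_right_le (k / 4)) hq)
    have h3 := fun y => hentry _ y hq
    have hmod : k % 4 < 4 := Nat.mod_lt _ (by omega)
    simp only [truthStep, List.length_map, List.length_range, Nat.add_sub_cancel, h1, h2, h3]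
    -- With two diamonds the coding has modulus `2 + 2 = 4`: the residues stand for variables,
    -- implications and the two diamonds.
    obtain h | h | h | h : k % 4 = 0 ∨ k % 4 = 1 ∨ k % 4 = 2 ∨ k % 4 = 3 := by omega
    all_goals
      simp only [codedTruth]
      rw [Formula.ofCode]
      simp [h, hx, Truth, codedVal, codedRel]
    · tauto
    · exact ⟨fun ⟨y, hy, hr, _, ht⟩ => ⟨⟨y, hy⟩, hr, ht⟩, fun ⟨y, hr, ht⟩ => ⟨y.1, y.2, hr, y.2, ht⟩⟩
    · exact ⟨fun ⟨y, hy, hr, _, ht⟩ => ⟨⟨y, hy⟩, hr, ht⟩, fun ⟨y, hr, ht⟩ => ⟨y.1, y.2, hr, y.2, ht⟩⟩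

/-- Course-of-values recursion on the code: immediate subformulas have smaller codes, so their rows
are already in the table. -/
theorem primrec_truthTable : Primrec₂ truthTable := by
  classical
  refine Primrec.nat_strong_rec truthTable (g := fun a l => some ((List.range a.1).map fun x =>
    decide (truthStep a.1 a.2.1 a.2.2 l ((l.length - 1) / 4) x))) ?_ fun a c => ?_
  · refine Primrec.option_some.comp (Primrec.list_map
      (Primrec.list_range.comp (Primrec.fst.comp Primrec.fst)) (PrimrecPred.decide ?_))
    have h1 : Primrec fun b : ((ℕ × ℕ × ℕ) × List (List Bool)) × ℕ => b.1.1 :=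
      Primrec.fst.comp Primrec.fst
    have h2 : Primrec fun b : ((ℕ × ℕ × ℕ) × List (List Bool)) × ℕ => b.1.2 :=
      Primrec.snd.comp Primrec.fst
    exact primrecPred_truthStep (Primrec.fst.comp h1) (Primrec.fst.comp (Primrec.snd.comp h1))
      (Primrec.snd.comp (Primrec.snd.comp h1)) h2 (Primrec.nat_div.comp (Primrec.nat_sub.comp
        (Primrec.list_length.comp h2) (Primrec.const 1)) (Primrec.const 4)) Primrec.snd
  · rw [Option.some_inj, truthTable]
    refine List.map_congr_left fun x hx => ?_
    rw [decide_eq_decide]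
    simpa using truthStep_iff (c := c) (List.mem_range.1 hx)

theorem primrecPred_codedTruth {α : Type*} [Primcodable α] {f : α → ℕ × ℕ × ℕ} {g h : α → ℕ}
    (hf : Primrec f) (hg : Primrec g) (hh : Primrec h) :
    PrimrecPred fun a => codedTruth (f a) (g a) (h a) :=
  (Primrec.eq.comp ((Primrec.list_getD false).comp (primrec_truthTable.comp hf hg) hh)
    (Primrec.const true)).of_eq fun _ => getD_truthTable

/-- Validity of the formula with the code `c` on a coded frame. -/
def codedValid (N r c : ℕ) : Prop :=
  ∀ v < 2 ^ ((c + 1) * N), ∀ x < N, codedTruth (N, r, v) c x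

theorem primrecPred_codedValid {α : Type*} [Primcodable α] {N r c : α → ℕ} (hN : Primrec N)
    (hr : Primrec r) (hc : Primrec c) : PrimrecPred fun a => codedValid (N a) (r a) (c a) := by
  have h1 : PrimrecPred fun b : ℕ × ℕ × α =>
      codedTruth (N b.2.2, r b.2.2, b.2.1) (c b.2.2) b.1 :=
    primrecPred_codedTruth (Primrec.pair (hN.comp (Primrec.snd.comp Primrec.snd))
      (Primrec.pair (hr.comp (Primrec.snd.comp Primrec.snd)) (Primrec.fst.comp Primrec.snd)))
      (hc.comp (Primrec.snd.comp Primrec.snd)) Primrec.fst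
  have h2 : PrimrecPred fun b : ℕ × α =>
      ∀ x < N b.2, codedTruth (N b.2, r b.2, b.1) (c b.2) x :=
    primrecPred_forall_lt (hN.comp Primrec.snd) h1
  exact primrecPred_forall_lt (primrec_pow.comp (Primrec.const 2)
    (Primrec.nat_mul.comp (Primrec.succ.comp hc) hN)) h2

theorem truth_congr {k : ℕ} {W : Type*} {R : Fin k → W → W → Prop} {θ θ' : ℕ → Set W} {c : ℕ}
    (hθ : ∀ p ≤ c, θ p = θ' p) {φ : Formula k} (hφ : φ.toCode ≤ c) {w : W} :
    Truth R θ w φ ↔ Truth R θ' w φ := by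
  induction φ generalizing w with
  | var n =>
    have h1 : n ≤ (k + 2) * n := Nat.le_mul_of_pos_left _ (by omega)
    rw [Formula.toCode] at hφ
    rw [Truth, Truth, hθ n (by omega)]
  | bot => rfl
  | imp φ ψ ih1 ih2 =>
    have h1 : Nat.pair φ.toCode ψ.toCode ≤ (k + 2) * Nat.pair φ.toCode ψ.toCode :=
      Nat.le_mul_of_pos_left _ (by omega)
    have h2 := Nat.left_le_pair φ.toCode ψ.toCode
    have h3 := Nat.right_le_pair φ.toCode ψ.toCode
    rw [Formula.toCode] at hφ
    rw [Truth, Truth, ih1 (by omega), ih2 (by omega)]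
  | dia i φ ih =>
    have h1 : φ.toCode ≤ (k + 2) * φ.toCode := Nat.le_mul_of_pos_left _ (by omega)
    rw [Formula.toCode] at hφ
    simp only [Truth, ih (show φ.toCode ≤ c by omega)]

theorem codedValid_iff {N r : ℕ} {φ : Formula 2} :
    codedValid N r φ.toCode ↔ ValidOn (codedRel N r) φ := by
  have hdiv : ∀ p : ℕ, ∀ x : Fin N, (p * N + x.1) / N = p ∧ (p * N + x.1) % N = x.1 := by
    intro p x
    have hN : 0 < N := x.pos
    rw [mul_comm, Nat.mul_add_div hN, Nat.mul_add_mod, Nat.div_eq_of_lt x.2, Nat.mod_eq_of_lt x.2]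
    exact ⟨add_zero p, rfl⟩
  constructor
  · intro h θ w
    -- Variables of `φ` have indices at most its code, so `(φ.toCode + 1) * N` binary digits
    -- describe all of the valuation that matters.
    obtain ⟨v, hv, hbits⟩ := exists_testBit_iff
      (fun i => ∃ hi : i % N < N, (⟨i % N, hi⟩ : Fin N) ∈ θ (i / N)) ((φ.toCode + 1) * N)
    obtain ⟨hw, ht⟩ := h v hv w.1 w.2
    rw [Formula.ofCode_toCode] at ht
    refine (truth_congr (c := φ.toCode) (fun p hp => ?_) le_rfl).1 ht
    ext x
    have hlt : p * N + x.1 < (φ.toCode + 1) * N := by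
      have : (p + 1) * N ≤ (φ.toCode + 1) * N := Nat.mul_le_mul_right _ (by omega)
      have := x.2
      linarith [add_mul p 1 N]
    change v.testBit (p * N + x.1) = true ↔ _
    rw [hbits _ hlt]
    simp only [hdiv p x, Fin.eta, x.2, exists_true_left]
  · intro h v _ x hx
    refine ⟨hx, ?_⟩
    rw [Formula.ofCode_toCode]
    exact h _ _

theorem exists_codedRel {N : ℕ} (R : Fin N → Fin N → Prop) :
    ∃ r < 2 ^ (N * N), codedRel N r = ![R, fun x y => R y x] := by
  have hdiv : ∀ x y : Fin N, (x.1 * N + y.1) / N = x.1 ∧ (x.1 * N + y.1) % N = y.1 := by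
    intro x y
    have hN : 0 < N := x.pos
    rw [mul_comm, Nat.mul_add_div hN, Nat.mul_add_mod, Nat.div_eq_of_lt y.2, Nat.mod_eq_of_lt y.2]
    exact ⟨add_zero _, rfl⟩
  obtain ⟨r, hr, hbits⟩ := exists_testBit_iff
    (fun i => ∃ (h1 : i / N < N) (h2 : i % N < N), R ⟨i / N, h1⟩ ⟨i % N, h2⟩) (N * N)
  have key : ∀ x y : Fin N, r.testBit (x.1 * N + y.1) = true ↔ R x y := by
    intro x y
    have hlt : x.1 * N + y.1 < N * N := by
      have : (x.1 + 1) * N ≤ N * N := Nat.mul_le_mul_right _ x.2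
      have := y.2
      linarith [add_mul x.1 1 N]
    rw [hbits _ hlt]
    simp only [hdiv x y, Fin.eta, x.2, y.2, exists_true_left]
  refine ⟨r, hr, ?_⟩
  funext i x y
  fin_cases i
  · exact propext (key x y)
  · exact propext (key y x)

end Coding

/-! ### Decidability -/

section Decidability

theorem primrec_tunedBound (h e : ℕ) : Primrec (tunedBound h e) := by
  refine Primrec.nat_iterate (Primrec.const h) (Primrec.nat_mul.comp Primrec.id (Primrec.const h))
    (h := fun _ N => N * 2 ^ (e * N)) ?_
  exact Primrec.nat_mul.comp Primrec.snd (primrec_pow.comp (Primrec.const 2)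
    (Primrec.nat_mul.comp (Primrec.const e) Primrec.snd))

/-- The number of points that suffices to refute the formula with the code `c`. -/
def modelBound (h e c : ℕ) : ℕ := tunedBound h e (2 ^ (c + 1))

theorem primrec_modelBound (h e : ℕ) : Primrec (modelBound h e) :=
  (primrec_tunedBound h e).comp (primrec_pow.comp (Primrec.const 2) Primrec.succ)

variable {C : Set (Frame.{u} 1)}

/-- A class of frames of bounded height that is closed under quotients by tuned partitions. -/
structure AdmitsTunedQuotients (C : Set (Frame.{u} 1)) (h e : ℕ) : Prop where
  pos : 1 ≤ e
  heightLe : ∀ F ∈ C, HeightLe (F.R 0) h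
  quotient_mem : ∀ F ∈ C, ∀ s : Setoid F.W, IsTuned (stepsMod e (F.R 0) 1) s →
    (⟨Quotient s, F.nonempty.map (Quotient.mk s), fun _ => quotRel s (F.R 0)⟩ : Frame.{u} 1) ∈ C

/-- The finite model property with a bound on the size of models. -/
theorem AdmitsTunedQuotients.exists_fin {h e : ℕ} (hC : AdmitsTunedQuotients C h e)
    {Ax : Set (Formula 1)} (hAx : IsCanonicallyDefinedBy C Ax) {φ : Formula 2}
    (hφ : φ ∉ Log (tenseClass C)) :
    ∃ N ≤ modelBound h e φ.toCode, ∃ R : Fin N → Fin N → Prop,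
      (∀ ψ ∈ Ax, ValidOn (fun _ => R) ψ) ∧ ¬ ValidOn ![R, fun x y => R y x] φ := by
  simp only [Log, tenseClass, Set.mem_ofPred_eq, Set.forall_mem_image, not_forall] at hφ
  obtain ⟨F, hF, hn⟩ := hφ
  simp only [ValidOn, not_forall] at hn
  obtain ⟨θ, w, hn⟩ := hn
  -- Points are labelled by the set of codes up to `φ.toCode` of formulas true there, hence the `2 ^
  -- (c + 1)` in `modelBound`.
  obtain ⟨s, hs, htuned, hfin, hcard⟩ := exists_tuned_refinement hC.pos
    (heightLe_iff.1 (hC.heightLe F hF)) fun x : F.W =>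
      {i : Fin (φ.toCode + 1) | Truth F.tense.R θ x (Formula.ofCode i.1)}
  have hs' : ∀ x y, s x y → ∀ ψ : Formula 2, ψ.toCode ≤ φ.toCode →
      (Truth F.tense.R θ x ψ ↔ Truth F.tense.R θ y ψ) := by
    intro x y hxy ψ hψ
    have := Set.ext_iff.1 (hs x y hxy) ⟨ψ.toCode, by omega⟩
    simpa only [Set.mem_ofPred_eq, Formula.ofCode_toCode] using this
  have ht := (truth_quotRel hs' le_rfl (w := w)).not.2 hn
  have hQ := (hAx.mem_iff _).1 (hC.quotient_mem F hF s htuned)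
  let f := Finite.equivFin (Quotient s)
  let R : Fin (Nat.card (Quotient s)) → Fin (Nat.card (Quotient s)) → Prop :=
    fun x y => quotRel s (F.R 0) (f.symm x) (f.symm y)
  refine ⟨Nat.card (Quotient s), by simpa [modelBound] using hcard, R,
    fun ψ hψ => (validOn_equiv f.symm (R' := fun _ => quotRel s (F.R 0)) ?_).2 (hQ ψ hψ),
    fun hv => ht ?_⟩
  · exact fun _ _ _ => Iff.rfl
  · refine (validOn_equiv f (R' := ![R, fun x y => R y x]) fun i a b => ?_).2 hv _ _
    fin_cases i
    · simp [R, Frame.tense]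
    · simp only [R, Frame.tense]
      -- Exchanging the two representatives identifies the quotient of the converse with the
      -- converse of the quotient.
      exact ⟨fun ⟨x, y, hx, hy, hxy⟩ => ⟨y, x, by simpa using hy, by simpa using hx, hxy⟩,
        fun ⟨y, x, hy, hx, hxy⟩ => ⟨x, y, by simpa using hx, by simpa using hy, hxy⟩⟩

/-- Membership of a coded frame in the class is tested by validity of its two axioms, so the
right-hand side is a bounded search. -/
theorem AdmitsTunedQuotients.mem_log_iff {h e : ℕ} (hC : AdmitsTunedQuotients C h e)
    {a b : Formula 1} (hAx : IsCanonicallyDefinedBy C {a, b}) {φ : Formula 2} :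
    φ ∈ Log (tenseClass C) ↔ ∀ N < modelBound h e φ.toCode + 1, ∀ r < 2 ^ (N * N),
      codedValid N r (toFirst a).toCode → codedValid N r (toFirst b).toCode →
        codedValid N r φ.toCode := by
  have hfirst : ∀ {N r : ℕ} {ψ : Formula 1}, codedValid N r (toFirst ψ).toCode ↔
      ValidOn (fun _ => codedRel N r 0) ψ := by
    intro N r ψ
    rw [codedValid_iff]
    exact forall_congr' fun θ => forall_congr' fun w => truth_toFirst
  constructor
  · intro hφ N _ r _ h1 h2
    rw [hfirst] at h1 h2
    rw [codedValid_iff]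
    intro θ w
    -- The case `N = 0` is vacuous: the point `w` witnesses nonemptiness.
    have hmem : liftFrame.{u} ⟨w⟩ (fun _ : Fin 1 => codedRel N r 0) ∈ C := by
      refine (hAx.liftFrame_mem _).2 ?_
      rintro ψ (rfl | rfl)
      · exact h1
      · exact h2
    have hφ' := hφ _ ⟨_, hmem, rfl⟩
    rw [liftFrame_tense ⟨w⟩ (codedRel N r) fun _ _ => Iff.rfl] at hφ'
    exact (validOn_liftFrame _ _).1 hφ' θ w
  · intro hall
    by_contra hφ
    obtain ⟨N, hN, R, hR, hn⟩ := hC.exists_fin hAx hφ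
    obtain ⟨r, hr, hrR⟩ := exists_codedRel R
    have h0 : codedRel N r 0 = R := by rw [hrR]; rfl
    refine hn ?_
    rw [← hrR, ← codedValid_iff]
    refine hall N (by omega) r hr (hfirst.2 ?_) (hfirst.2 ?_)
    · rw [h0]; exact hR a (Or.inl rfl)
    · rw [h0]; exact hR b (Or.inr rfl)

theorem AdmitsTunedQuotients.computablePred {h e : ℕ} (hC : AdmitsTunedQuotients C h e)
    {a b : Formula 1} (hAx : IsCanonicallyDefinedBy C {a, b}) :
    ComputablePred fun φ : Formula 2 => φ ∈ Log (tenseClass C) := by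
  have hval : ∀ {c : ℕ × ℕ × Formula 2 → ℕ}, Primrec c →
      PrimrecPred fun p : ℕ × ℕ × Formula 2 => codedValid p.2.1 p.1 (c p) := fun hc =>
    primrecPred_codedValid (Primrec.fst.comp Primrec.snd) Primrec.fst hc
  have h1 : PrimrecPred fun p : ℕ × ℕ × Formula 2 =>
      codedValid p.2.1 p.1 (toFirst a).toCode → codedValid p.2.1 p.1 (toFirst b).toCode →
        codedValid p.2.1 p.1 p.2.2.toCode := by
    refine PrimrecPred.of_eq ((hval (Primrec.const (toFirst a).toCode)).not.or
      ((hval (Primrec.const (toFirst b).toCode)).not.or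
        (hval (Primrec.encode.comp (Primrec.snd.comp Primrec.snd))))) fun p => ?_
    -- The encoding of a formula as a natural number is its Gödel number by definition.
    change (¬ _ ∨ ¬ _ ∨ codedValid p.2.1 p.1 p.2.2.toCode) ↔ _
    tauto
  have h2 : PrimrecPred fun p : ℕ × Formula 2 => ∀ r < 2 ^ (p.1 * p.1),
      codedValid p.1 r (toFirst a).toCode → codedValid p.1 r (toFirst b).toCode →
        codedValid p.1 r p.2.toCode :=
    primrecPred_forall_lt (primrec_pow.comp (Primrec.const 2)
      (Primrec.nat_mul.comp Primrec.fst Primrec.fst)) h1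
  have h3 : PrimrecPred fun φ : Formula 2 => φ ∈ Log (tenseClass C) :=
    (primrecPred_forall_lt (Primrec.succ.comp ((primrec_modelBound h e).comp Primrec.encode))
      h2).of_eq fun φ => (hC.mem_log_iff hAx).symm
  obtain ⟨hdec, hprim⟩ := h3
  exact ⟨hdec, hprim.to_comp⟩

end Decidability

/-! ### The two families of classes -/

section Classes

theorem heightLe_of_universal {W : Type*} {R : W → W → Prop} {h : ℕ} (hh : 1 ≤ h)
    (hR : ∀ x y, R x y) : HeightLe R h :=
  heightLe_iff.2 fun _ hx =>
    have ⟨_, _, hn, _⟩ := DepthAtLeast.anti (i := 1) hh hx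
    hn (.single (hR _ _))

/-- The frame with one reflexive point. -/
def pointFrame : Frame.{u} 1 := ⟨PUnit, ⟨⟨⟩⟩, fun _ _ _ => True⟩

theorem relPow_pointFrame (j : ℕ) (x y : PUnit.{u + 1}) : relPow (pointFrame.{u}.R 0) j x y := by
  induction j with
  | zero => rfl
  | succ j ih => exact ⟨y, ih, trivial⟩

theorem pointFrame_mem_classF {m n h : ℕ} (hh : 1 ≤ h) : pointFrame.{u} ∈ classF m n h :=
  ⟨fun x y _ => relPow_pointFrame m x y, heightLe_of_universal hh fun _ _ => trivial⟩

theorem pointFrame_mem_classG {m h : ℕ} (hh : 1 ≤ h) : pointFrame.{u} ∈ classG m h :=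
  ⟨fun _ _ => ⟨fun _ => ⟨0, Nat.zero_le _, rfl⟩, fun _ => .refl⟩,
    heightLe_of_universal hh fun _ _ => trivial⟩

theorem isCanonicallyDefinedBy_classF {m n h : ℕ} (hmn : m < n) (hh : 1 ≤ h) :
    IsCanonicallyDefinedBy (classF.{u} m n h) (axiomsF m n h) where
  mem_iff _ := ⟨fun hF => validOn_axiomsF hmn hh hF.1 hF.2, fun hF =>
    classF_of_validFor (isSeparating_univ _) hmn hh fun ψ hψ => validFor_univ.2 (hF ψ hψ)⟩
  validOn hP hv :=
    have hR := classF_of_validFor hP hmn hh hv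
    validOn_axiomsF hmn hh hR.1 hR.2

theorem isCanonicallyDefinedBy_classG {m h : ℕ} (hh : 1 ≤ h) :
    IsCanonicallyDefinedBy (classG.{u} m h) (axiomsG m h) where
  mem_iff _ := ⟨fun hF => validOn_axiomsG hh hF.1 hF.2, fun hF =>
    classG_of_validFor (isSeparating_univ _) hh fun ψ hψ => validFor_univ.2 (hF ψ hψ)⟩
  validOn hP hv :=
    have hR := classG_of_validFor hP hh hv
    validOn_axiomsG hh hR.1 hR.2

theorem admitsTunedQuotients_classF {m n h : ℕ} (hmn : m < n) :
    AdmitsTunedQuotients (classF.{u} m n h) h (n - m) where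
  pos := by omega
  heightLe _ hF := hF.2
  quotient_mem _ hF _ hs := ⟨hF.1.quotRel hmn hs, hF.2.quotRel hs⟩

theorem admitsTunedQuotients_classG {m h : ℕ} : AdmitsTunedQuotients (classG.{u} m h) h 1 where
  pos := le_rfl
  heightLe _ hF := hF.2
  quotient_mem _ hF _ hs := ⟨hF.1.quotRel hs, hF.2.quotRel hs⟩

end Classes

end Modal

theorem mainTheorem12 (m n h : ℕ) (hm : 1 ≤ m) (hmn : m < n) (hh : 1 ≤ h) :
    (ComputablePred (fun φ : Modal.Formula 2 =>
        φ ∈ Modal.Log (Modal.tenseClass (Modal.classF.{u} m n h))) ∧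
      Modal.Log (Modal.classF.{u} m n h) = Modal.leastLogic (Modal.axiomsF m n h) ∧
      Modal.IsCanonical (Modal.Log (Modal.classF.{u} m n h)) ∧
      Modal.Log (Modal.tenseClass (Modal.classF.{u} m n h)) =
        Modal.tenseExtension (Modal.Log (Modal.classF.{u} m n h))) ∧
    (ComputablePred (fun φ : Modal.Formula 2 =>
        φ ∈ Modal.Log (Modal.tenseClass (Modal.classG.{u} m h))) ∧
      Modal.Log (Modal.classG.{u} m h) = Modal.leastLogic (Modal.axiomsG m h) ∧
      Modal.IsCanonical (Modal.Log (Modal.classG.{u} m h)) ∧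
      Modal.Log (Modal.tenseClass (Modal.classG.{u} m h)) =
        Modal.tenseExtension (Modal.Log (Modal.classG.{u} m h))) := by
  have hF := Modal.isCanonicallyDefinedBy_classF.{u} (m := m) hmn hh
  have hG := Modal.isCanonicallyDefinedBy_classG.{u} (m := m) hh
  exact ⟨⟨(Modal.admitsTunedQuotients_classF hmn).computablePred hF, hF.log_eq,
      hF.isCanonical_log ⟨_, Modal.pointFrame_mem_classF hh⟩, hF.log_tenseClass⟩,
    ⟨Modal.admitsTunedQuotients_classG.computablePred hG, hG.log_eq,
      hG.isCanonical_log ⟨_, Modal.pointFrame_mem_classG hh⟩, hG.log_tenseClass⟩⟩
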